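/- Fix countably infinite sets of concept names, role names and individual names. A role is a role name $r$ or its inverse $r^-$, with $(r^-)^-=r$. A Horn-$\mathcal{ALCHIF}$ TBox (in normal form) is a finite set of axioms of the forms $\top\sqsubseteq A$, $A\sqsubseteq\bot$, $A_1\sqcap A_2\sqsubseteq B$, $A\sqsubseteq\exists r.B$, $A\sqsubseteq\forall r.B$, $r\sqsubseteq s$, $\mathsf{func}(r)$ with $A,A_1,A_2,B$ concept names and $r,s$ roles, in which functional roles have no subroles: if $r\sqsubseteq s\in\mathcal T$, then neither $\mathsf{func}(s)$ nor $\mathsf{func}(s^-)$ is in $\mathcal T$. An ABox is a finite non-empty set of assertions $A(a)$, $r(a,b)$ over individual names; $\mathsf{ind}(\mathcal A)$ is the set of its individuals. It is tree-shaped if it has no assertion $r(a,a)$, the undirected graph of its role assertions on $\mathsf{ind}(\mathcal A)$ is a tree, and any two distinct individuals occur together in at most one role assertion. Interpretations have the usual semantics under the standard name assumption: individual names that belong to the domain denote themselves, and a model of $\mathcal A$ contains $\mathsf{ind}(\mathcal A)$. An interpretation is weakly tree-shaped if no element is related to itself by a role and the undirected graph of its role edges is a tree, and finitely branching if every element has only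 finitely many directly connected elements. Signatures are sets of concept and role names. $\mathcal T_1$ $(\Sigma_A,\Sigma_Q)$-CQ entails $\mathcal T_2$ if for all $\Sigma_A$-ABoxes $\mathcal A$ consistent with $\mathcal T_1$ and with $\mathcal T_2$, all conjunctive queries $q(\mathbf x)$ over $\Sigma_Q$ and all tuples $\mathbf a$ from $\mathsf{ind}(\mathcal A)$, $\mathcal T_2,\mathcal A\models q(\mathbf a)$ implies $\mathcal T_1,\mathcal A\models q(\mathbf a)$. We write $\mathcal T_1\models^{\mathrm{RI}}_{\Sigma_A,\Sigma_Q}\mathcal T_2$ if $\mathcal T_2\models r\sqsubseteq s$ implies $\mathcal T_1\models r\sqsubseteq s$ for all $\Sigma_A$-roles $r$ and $\Sigma_Q$-roles $s$. A $\Sigma$-homomorphism $\mathcal I\to_\Sigma\mathcal J$ is a map of the domains that preserves the concept and role names of $\Sigma$ and is the identity on the individual names in the domain of $\mathcal I$; $\mathcal I\to^{\mathrm{fin}}_\Sigma\mathcal J$ means that $\mathcal I'\to_\Sigma\mathcal J$ for every finite (induced) subinterpretation $\mathcal I'$ of $\mathcal I$. A $\mathcal T$-type is a set $t$ of concept names occurring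 in $\mathcal T$ such that $\mathcal T\models\bigsqcap t\sqsubseteq A$ implies $A\in t$, for all concept names $A$. For $\mathcal A$ consistent with $\mathcal T$, write $t\rightsquigarrow_r t'$ (respectively $a\rightsquigarrow_r t'$) if $t'$ is a maximal $\mathcal T$-type with $\mathcal T\models\bigsqcap t\sqsubseteq\exists r.\bigsqcap t'$ (respectively $\mathcal T,\mathcal A\models\exists r.\bigsqcap t'(a)$). The domain of the universal model $\mathcal I_{\mathcal T,\mathcal A}$ is the set of paths $a r_0t_1r_1\cdots r_{n-1}t_n$ ($n\ge 0$) with $a\in\mathsf{ind}(\mathcal A)$, roles $r_i$ and $\mathcal T$-types $t_i$ such that $a\rightsquigarrow_{r_0}t_1$, where, if $\mathsf{func}(r_0)\in\mathcal T$, there is no $b\in\mathsf{ind}(\mathcal A)$ with $\mathcal T,\mathcal A\models r_0(a,b)$; and $t_i\rightsquigarrow_{r_i}t_{i+1}$, where $r_{i-1}\ne r_i^-$ if $\mathsf{func}(r_i)\in\mathcal T$ ($1\le i<n$). A concept name $A$ holds at $a$ if $\mathcal T,\mathcal A\models A(a)$, and at a path with $n>0$ if $\mathcal T\models\bigsqcap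 t_n\sqsubseteq A$. A role name $r$ consists of the pairs $(a,b)$ with $s(a,b)\in\mathcal A$ and $\mathcal T\models s\sqsubseteq r$, the pairs $(\pi,\pi st)$ with $\mathcal T\models s\sqsubseteq r$, and the pairs $(\pi st,\pi)$ with $\mathcal T\models s^-\sqsubseteq r$, for roles $s$ (where $p^-(a,b)\in\mathcal A$ means $p(b,a)\in\mathcal A$). For a type $t$, $\mathcal I_{\mathcal T,t}$ is $\mathcal I_{\mathcal T,\{A(a)\mid A\in t\}}$ for a fixed individual name $a$ (it is empty if $t=\emptyset$). For a model $\mathcal I_1$, $\mathsf{tp}_{\mathcal I_1}(a)$ is the set of concept names $A$ occurring in $\mathcal T_1$ with $a\in A^{\mathcal I_1}$. $\mathcal I|^{\mathrm{con}}_\Sigma$ is the restriction of $\mathcal I$ to the elements reachable from an individual along $\Sigma$-roles (forwards or backwards). A $\Sigma$-subtree in $\mathcal I_{\mathcal T,\mathcal A}$ is a maximal weakly tree-shaped subinterpretation that contains no individual and in which any two elements are linked by a path of $\Sigma$-role edges. Theorem. Let $\mathcal T_1,\mathcal T_2$ be Horn-$\mathcal{ALCHIF}$ TBoxes in normal form and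 $\Sigma_A,\Sigma_Q$ signatures with $\mathcal T_1\models^{\mathrm{RI}}_{\Sigma_A,\Sigma_Q}\mathcal T_2$. Then $\mathcal T_1$ $(\Sigma_A,\Sigma_Q)$-CQ entails $\mathcal T_2$ if and only if for all tree-shaped $\Sigma_A$-ABoxes $\mathcal A$ consistent with $\mathcal T_1$ and with $\mathcal T_2$, and all weakly tree-shaped, finitely branching models $\mathcal I_1$ of $\mathcal A$ and $\mathcal T_1$: 1. $\mathcal I_{\mathcal T_2,\mathcal A}|^{\mathrm{con}}_{\Sigma_Q}\to_{\Sigma_Q}\mathcal I_1$; and 2. for every $\Sigma_Q$-subtree $\mathcal I$ in $\mathcal I_{\mathcal T_2,\mathcal A}$, (a) $\mathcal I\to_{\Sigma_Q}\mathcal I_1$, or (b) $\mathcal I\to^{\mathrm{fin}}_{\Sigma_Q}\mathcal I_{\mathcal T_1,\mathsf{tp}_{\mathcal I_1}(a)}$ for some $a\in\mathsf{ind}(\mathcal A)$. -/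

import Mathlib

namespace HornDL

/-- A role: a role name or the inverse of a role name. -/
inductive Role (NR : Type) : Type
  | fwd (r : NR)
  | bwd (r : NR)

/-- The inverse of a role, with `(r⁻)⁻ = r`. -/
def Role.inv {NR : Type} : Role NR → Role NR
  | .fwd r => .bwd r
  | .bwd r => .fwd r

/-- The role name underlying a role. -/
def Role.name {NR : Type} : Role NR → NR
  | .fwd r => r
  | .bwd r => r

/-- A signature: a set of concept names and role names. -/
structure Sig (NC NR : Type) where
  conc : Set NC
  role : Set NR

/-- The axioms of Horn-ALCHIF in normal form. -/
inductive Ax (NC NR : Type) : Type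
  /-- `⊤ ⊑ A` -/
  | top (A : NC)
  /-- `A ⊑ ⊥` -/
  | bot (A : NC)
  /-- `A₁ ⊓ A₂ ⊑ B` -/
  | conj (A₁ A₂ B : NC)
  /-- `A ⊑ ∃ r.B` -/
  | ex (A : NC) (r : Role NR) (B : NC)
  /-- `A ⊑ ∀ r.B` -/
  | all (A : NC) (r : Role NR) (B : NC)
  /-- `r ⊑ s` -/
  | ri (r s : Role NR)
  /-- `func(r)` -/
  | func (r : Role NR)

/-- The concept names that occur in an axiom. -/
def Ax.concNames {NC NR : Type} : Ax NC NR → List NC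
  | .top A => [A]
  | .bot A => [A]
  | .conj A₁ A₂ B => [A₁, A₂, B]
  | .ex A _ B => [A, B]
  | .all A _ B => [A, B]
  | .ri _ _ => []
  | .func _ => []

/-- A Horn-ALCHIF TBox in normal form. Functional roles have no subroles; as `r ⊑ s` and
`r⁻ ⊑ s⁻` are the same statement, an axiom `r ⊑ s` excludes both `func(s)` and `func(s⁻)`. -/
structure TBox (NC NR : Type) where
  axioms : Finset (Ax NC NR)
  noSubrole : ∀ r s, Ax.ri r s ∈ axioms → Ax.func s ∉ axioms ∧ Ax.func s.inv ∉ axioms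

/-- The concept names that occur in a TBox. -/
def TBox.concNames {NC NR : Type} (T : TBox NC NR) : Set NC :=
  {A | ∃ α ∈ T.axioms, A ∈ α.concNames}

theorem TBox.concNames_finite {NC NR : Type} (T : TBox NC NR) : T.concNames.Finite := by
  classical
  refine (T.axioms.biUnion fun α => α.concNames.toFinset).finite_toSet.subset ?_
  rintro A ⟨α, hα, hA⟩
  simp only [Finset.coe_biUnion, Set.mem_iUnion]
  exact ⟨α, hα, by simpa using hA⟩

/-- An ABox: a finite set of concept assertions `A(a)` and role assertions `r(a,b)`. -/
structure ABox (NC NR NI : Type) where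
  conc : Finset (NC × NI)
  role : Finset (NR × NI × NI)

namespace ABox

variable {NC NR NI : Type}

/-- The individuals that occur in an ABox. -/
def ind (𝒜 : ABox NC NR NI) : Set NI :=
  {a | (∃ A, (A, a) ∈ 𝒜.conc) ∨ (∃ r b, (r, a, b) ∈ 𝒜.role) ∨ (∃ r b, (r, b, a) ∈ 𝒜.role)}

/-- `s(a,b) ∈ 𝒜` for a possibly inverse role `s`, where `r⁻(a,b)` stands for `r(b,a)`. -/
def HasRole (𝒜 : ABox NC NR NI) : Role NR → NI → NI → Prop
  | .fwd r, a, b => (r, a, b) ∈ 𝒜.role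
  | .bwd r, a, b => (r, b, a) ∈ 𝒜.role

/-- The ABox uses only names from the signature. -/
def Over (𝒜 : ABox NC NR NI) (sg : Sig NC NR) : Prop :=
  (∀ p ∈ 𝒜.conc, p.1 ∈ sg.conc) ∧ (∀ p ∈ 𝒜.role, p.1 ∈ sg.role)

/-- The undirected graph of an ABox on its individuals. -/
def graph (𝒜 : ABox NC NR NI) : SimpleGraph 𝒜.ind :=
  SimpleGraph.fromRel fun a b => ∃ r, (r, a.1, b.1) ∈ 𝒜.role

/-- Tree-shaped ABoxes: no assertion `r(a,a)`, the undirected graph is a tree, and any two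
distinct individuals occur together in at most one role assertion. -/
def TreeShaped (𝒜 : ABox NC NR NI) : Prop :=
  (∀ r a, (r, a, a) ∉ 𝒜.role) ∧ 𝒜.graph.IsTree ∧
    ∀ a b, a ≠ b → {p | p ∈ 𝒜.role ∧ (p.2 = (a, b) ∨ p.2 = (b, a))}.Subsingleton

end ABox

/-- Interpretations under the standard name assumption. An element of the domain may be an
individual name (`nm d = some a`), each name is at most one element, and only names that belong
to the domain are interpreted. Non-emptiness of the domain is part of being a model. -/
structure Interp (NC NR NI : Type) where
  dom : Type
  conc : NC → Set dom
  role : NR → dom → dom → Prop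
  nm : dom → Option NI
  nm_inj : ∀ d e a, nm d = some a → nm e = some a → d = e

namespace Interp

variable {NC NR NI : Type}

/-- The extension of a possibly inverse role. -/
def ext (I : Interp NC NR NI) : Role NR → I.dom → I.dom → Prop
  | .fwd r, d, e => I.role r d e
  | .bwd r, d, e => I.role r e d

/-- Satisfaction of an axiom. -/
def Sat (I : Interp NC NR NI) : Ax NC NR → Prop
  | .top A => ∀ d, d ∈ I.conc A
  | .bot A => ∀ d, d ∉ I.conc A
  | .conj A₁ A₂ B => ∀ d, d ∈ I.conc A₁ → d ∈ I.conc A₂ → d ∈ I.conc B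
  | .ex A r B => ∀ d, d ∈ I.conc A → ∃ e, I.ext r d e ∧ e ∈ I.conc B
  | .all A r B => ∀ d, d ∈ I.conc A → ∀ e, I.ext r d e → e ∈ I.conc B
  | .ri r s => ∀ d e, I.ext r d e → I.ext s d e
  | .func r => ∀ d e e', I.ext r d e → I.ext r d e' → e = e'

/-- `I` is a model of the TBox `T`. -/
def ModelsT (I : Interp NC NR NI) (T : TBox NC NR) : Prop :=
  Nonempty I.dom ∧ ∀ α ∈ T.axioms, I.Sat α

/-- `I` is a model of the ABox `𝒜`. -/
def ModelsA (I : Interp NC NR NI) (𝒜 : ABox NC NR NI) : Prop :=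
  (∀ A a, (A, a) ∈ 𝒜.conc → ∃ d, I.nm d = some a ∧ d ∈ I.conc A) ∧
    ∀ r a b, (r, a, b) ∈ 𝒜.role → ∃ d e, I.nm d = some a ∧ I.nm e = some b ∧ I.role r d e

/-- The undirected graph of an interpretation. -/
def graph (I : Interp NC NR NI) : SimpleGraph I.dom :=
  SimpleGraph.fromRel fun d e => ∃ r, I.role r d e

/-- Weakly tree-shaped: no loops, and the undirected graph is a tree (multi-edges allowed). -/
def WeaklyTreeShaped (I : Interp NC NR NI) : Prop :=
  (∀ r d, ¬ I.role r d d) ∧ I.graph.IsTree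

/-- Every element has only finitely many directly connected elements. -/
def FinitelyBranching (I : Interp NC NR NI) : Prop :=
  ∀ d, {e | ∃ r, I.role r d e ∨ I.role r e d}.Finite

/-- One step along an edge labelled with a role from the signature, in either direction. -/
def Step (I : Interp NC NR NI) (sg : Sig NC NR) (d e : I.dom) : Prop :=
  ∃ r ∈ sg.role, I.role r d e ∨ I.role r e d

/-- Any two elements are linked by a path of edges labelled with roles of the signature. -/
def Connected (I : Interp NC NR NI) (sg : Sig NC NR) : Prop :=
  ∀ d e, Relation.ReflTransGen (I.Step sg) d e

/-- The subinterpretation with domain `S`. -/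
def restrict (I : Interp NC NR NI) (S : Set I.dom) : Interp NC NR NI where
  dom := S
  conc A := {d | d.1 ∈ I.conc A}
  role r d e := I.role r d.1 e.1
  nm d := I.nm d.1
  nm_inj d e a hd he := Subtype.ext (I.nm_inj d.1 e.1 a hd he)

/-- There is a homomorphism from `I` to `J` with respect to the signature; it is the identity
on individual names. -/
def HomTo (sg : Sig NC NR) (I J : Interp NC NR NI) : Prop :=
  ∃ h : I.dom → J.dom,
    (∀ d a, I.nm d = some a → J.nm (h d) = some a) ∧
    (∀ A ∈ sg.conc, ∀ d ∈ I.conc A, h d ∈ J.conc A) ∧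
    (∀ r ∈ sg.role, ∀ d e, I.role r d e → J.role r (h d) (h e))

/-- Every subinterpretation of `I` with at most `n` elements has a homomorphism to `J`. -/
def BddHomTo (n : ℕ) (sg : Sig NC NR) (I J : Interp NC NR NI) : Prop :=
  ∀ S : Set I.dom, S.encard ≤ n → HomTo sg (I.restrict S) J

/-- There is an `n`-bounded homomorphism for every `n`. -/
def FinHomTo (sg : Sig NC NR) (I J : Interp NC NR NI) : Prop :=
  ∀ n, BddHomTo n sg I J

/-- The restriction of `I` to the elements that are reachable from an individual along roles of
the signature, forwards or backwards. -/
def con (I : Interp NC NR NI) (sg : Sig NC NR) : Interp NC NR NI :=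
  I.restrict {d | ∃ c a, I.nm c = some a ∧ Relation.ReflTransGen (I.Step sg) c d}

/-- `S` is the domain of a maximal subinterpretation that is weakly tree-shaped, connected with
respect to the signature, and contains no individual. -/
def IsSubtree (I : Interp NC NR NI) (sg : Sig NC NR) (S : Set I.dom) : Prop :=
  Maximal (fun S : Set I.dom => (I.restrict S).WeaklyTreeShaped ∧ (I.restrict S).Connected sg ∧
    ∀ d ∈ S, I.nm d = none) S

/-- The `T`-type of an element: the concept names of `T` that it satisfies. -/
noncomputable def tp (I : Interp NC NR NI) (T : TBox NC NR) (d : I.dom) : Finset NC :=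
  (T.concNames_finite.subset (Set.inter_subset_left (t := {A | d ∈ I.conc A}))).toFinset

end Interp

/-- The ABox is consistent with the TBox. -/
def Consistent {NC NR NI : Type} (T : TBox NC NR) (𝒜 : ABox NC NR NI) : Prop :=
  ∃ I : Interp NC NR NI, I.ModelsT T ∧ I.ModelsA 𝒜

/-- A conjunctive query with answer variables `Fin ans` and quantified variables `Fin ex`. -/
structure CQ (NC NR : Type) where
  ans : ℕ
  ex : ℕ
  conc : List (NC × (Fin ans ⊕ Fin ex))
  role : List (NR × (Fin ans ⊕ Fin ex) × (Fin ans ⊕ Fin ex))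

/-- The query uses only names from the signature. -/
def CQ.Over {NC NR : Type} (q : CQ NC NR) (sg : Sig NC NR) : Prop :=
  (∀ p ∈ q.conc, p.1 ∈ sg.conc) ∧ (∀ p ∈ q.role, p.1 ∈ sg.role)

/-- `I ⊨ q(a)`. -/
def Interp.Answers {NC NR NI : Type} (I : Interp NC NR NI) (q : CQ NC NR) (a : Fin q.ans → NI) :
    Prop :=
  ∃ π : Fin q.ans ⊕ Fin q.ex → I.dom,
    (∀ p ∈ q.conc, π p.2 ∈ I.conc p.1) ∧
    (∀ p ∈ q.role, I.role p.1 (π p.2.1) (π p.2.2)) ∧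
    ∀ i, I.nm (π (.inl i)) = some (a i)

/-- `T, 𝒜 ⊨ q(a)`. -/
def CertainAnswer {NC NR NI : Type} (T : TBox NC NR) (𝒜 : ABox NC NR NI) (q : CQ NC NR)
    (a : Fin q.ans → NI) : Prop :=
  ∀ I : Interp NC NR NI, I.ModelsT T → I.ModelsA 𝒜 → I.Answers q a

/-- `T₁` `(sA, sQ)`-CQ entails `T₂`. ABoxes are non-empty. -/
def CQEntails {NC NR : Type} (NI : Type) (sA sQ : Sig NC NR) (T₁ T₂ : TBox NC NR) : Prop :=
  ∀ 𝒜 : ABox NC NR NI, 𝒜.ind.Nonempty → 𝒜.Over sA → Consistent T₁ 𝒜 → Consistent T₂ 𝒜 →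
    ∀ q : CQ NC NR, q.Over sQ → ∀ a : Fin q.ans → NI, (∀ i, a i ∈ 𝒜.ind) →
      CertainAnswer T₂ 𝒜 q a → CertainAnswer T₁ 𝒜 q a

section Consequence

variable {NC NR : Type} (NI : Type)

/-- `T ⊨ r ⊑ s`. -/
def EntailsRI (T : TBox NC NR) (r s : Role NR) : Prop :=
  ∀ I : Interp NC NR NI, I.ModelsT T → ∀ d e, I.ext r d e → I.ext s d e

/-- `T ⊨ ⨅t ⊑ A`. -/
def EntailsSub (T : TBox NC NR) (t : Set NC) (A : NC) : Prop :=
  ∀ I : Interp NC NR NI, I.ModelsT T → ∀ d, (∀ B ∈ t, d ∈ I.conc B) → d ∈ I.conc A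

/-- `T ⊨ ⨅t ⊑ ∃ r.⨅t'`. -/
def EntailsEx (T : TBox NC NR) (t : Set NC) (r : Role NR) (t' : Set NC) : Prop :=
  ∀ I : Interp NC NR NI, I.ModelsT T → ∀ d, (∀ B ∈ t, d ∈ I.conc B) →
    ∃ e, I.ext r d e ∧ ∀ B ∈ t', e ∈ I.conc B

/-- `T₁ ⊨^RI T₂`: every inclusion of an `sA`-role in a `sQ`-role that follows from `T₂` follows
from `T₁`. -/
def RIEntails (sA sQ : Sig NC NR) (T₁ T₂ : TBox NC NR) : Prop :=
  ∀ r s : Role NR, r.name ∈ sA.role → s.name ∈ sQ.role → EntailsRI NI T₂ r s → EntailsRI NI T₁ r s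

/-- `t` is a `T`-type. -/
def IsType (T : TBox NC NR) (t : Set NC) : Prop :=
  t ⊆ T.concNames ∧ ∀ A, EntailsSub NI T t A → A ∈ t

/-- `t ⇝_r t'` with respect to `T`. -/
def Succ (T : TBox NC NR) (t : Set NC) (r : Role NR) (t' : Set NC) : Prop :=
  IsType NI T t ∧ Maximal (fun t' => IsType NI T t' ∧ EntailsEx NI T t r t') t'

end Consequence

section Universal

variable {NC NR NI : Type} (T : TBox NC NR) (𝒜 : ABox NC NR NI)

/-- `T, 𝒜 ⊨ A(a)`. -/
def EntailsConcA (A : NC) (a : NI) : Prop :=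
  ∀ I : Interp NC NR NI, I.ModelsT T → I.ModelsA 𝒜 → ∃ d, I.nm d = some a ∧ d ∈ I.conc A

/-- `T, 𝒜 ⊨ r(a,b)`. -/
def EntailsRoleA (r : Role NR) (a b : NI) : Prop :=
  ∀ I : Interp NC NR NI, I.ModelsT T → I.ModelsA 𝒜 →
    ∃ d e, I.nm d = some a ∧ I.nm e = some b ∧ I.ext r d e

/-- `T, 𝒜 ⊨ (∃ r.⨅t)(a)`. -/
def EntailsExA (a : NI) (r : Role NR) (t : Set NC) : Prop :=
  ∀ I : Interp NC NR NI, I.ModelsT T → I.ModelsA 𝒜 →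
    ∃ d e, I.nm d = some a ∧ I.ext r d e ∧ ∀ B ∈ t, e ∈ I.conc B

/-- `a ⇝_r t` with respect to `T` and `𝒜`. -/
def SuccA (a : NI) (r : Role NR) (t : Set NC) : Prop :=
  Maximal (fun t => IsType NI T t ∧ EntailsExA T 𝒜 a r t) t

end Universal

/-- Sequences `a r₀ t₁ r₁ t₂ ⋯ r_{n-1} t_n`. -/
inductive RawPath (NC NR NI : Type) : Type
  | base (a : NI)
  | snoc (π : RawPath NC NR NI) (r : Role NR) (t : Set NC)

/-- The paths for `𝒜` and `T`. -/
def IsPath {NC NR NI : Type} (T : TBox NC NR) (𝒜 : ABox NC NR NI) : RawPath NC NR NI → Prop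
  | .base a => a ∈ 𝒜.ind
  | .snoc (.base a) r t => a ∈ 𝒜.ind ∧ SuccA T 𝒜 a r t ∧
      (Ax.func r ∈ T.axioms → ¬ ∃ b ∈ 𝒜.ind, EntailsRoleA T 𝒜 r a b)
  | .snoc (.snoc π r' t') r t => IsPath T 𝒜 (.snoc π r' t') ∧ Succ NI T t' r t ∧
      (Ax.func r ∈ T.axioms → r' ≠ r.inv)

/-- The individual name that a path is, if any. -/
def RawPath.nm {NC NR NI : Type} : RawPath NC NR NI → Option NI
  | .base a => some a
  | .snoc _ _ _ => none

theorem RawPath.nm_inj {NC NR NI : Type} :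
    ∀ (π π' : RawPath NC NR NI) (a : NI), π.nm = some a → π'.nm = some a → π = π'
  | .base _, .base _, _, h, h' => by
      cases h
      cases h'
      rfl
  | .snoc _ _ _, _, _, h, _ => by cases h
  | .base _, .snoc _ _ _, _, _, h' => by cases h'

/-- The concept names that hold at a path in the universal model. -/
def HoldsAt {NC NR NI : Type} (T : TBox NC NR) (𝒜 : ABox NC NR NI) (A : NC) :
    RawPath NC NR NI → Prop
  | .base a => EntailsConcA T 𝒜 A a
  | .snoc _ _ t => EntailsSub NI T t A

/-- The universal model of `T` and `𝒜`. -/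
def univ {NC NR NI : Type} (T : TBox NC NR) (𝒜 : ABox NC NR NI) : Interp NC NR NI where
  dom := {π : RawPath NC NR NI // IsPath T 𝒜 π}
  conc A := {π | HoldsAt T 𝒜 A π.1}
  role r π π' :=
    (∃ a b s, π.1 = .base a ∧ π'.1 = .base b ∧ 𝒜.HasRole s a b ∧ EntailsRI NI T s (.fwd r)) ∨
    (∃ s t, π'.1 = .snoc π.1 s t ∧ EntailsRI NI T s (.fwd r)) ∨
    (∃ s t, π.1 = .snoc π'.1 s t ∧ EntailsRI NI T s.inv (.fwd r))
  nm π := π.1.nm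
  nm_inj π π' a h h' := Subtype.ext (RawPath.nm_inj π.1 π'.1 a h h')

/-- The ABox `{A(a) | A ∈ t}` for a fixed individual name `a`. -/
noncomputable def typeABox {NC NR NI : Type} [Nonempty NI] (t : Finset NC) : ABox NC NR NI where
  conc := t ×ˢ {Classical.arbitrary NI}
  role := ∅

/-- The universal model of `T` and a type `t`. -/
noncomputable def univType {NC NR : Type} (NI : Type) [Nonempty NI] (T : TBox NC NR)
    (t : Finset NC) : Interp NC NR NI :=
  univ T (typeABox t)

end HornDL

/-! From left to right: a finite part of the universal model of `T₂` and `𝒜`, cut down to finitely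
many names, is a query, so query entailment maps it to every model of `T₁` and `𝒜`
(`CQEntails.exists_partial_hom`). Such maps are glued along an ultrafilter wherever images stay in
finite sets (`Interp.homTo_of_eventually`). On the part reachable from individuals they do, because
individuals are fixed and `I₁` is finitely branching. For a subtree the maps go into the chase of
`T₁` from the types of the individuals in `I₁`, which is finitely branching and folds into `I₁`. If
the images of one point come back to a bounded depth, a limit exists and gives (a). Otherwise images
of finite parts eventually lie strictly below a single individual. As there are finitely many
individuals, one of them serves all finite parts, and the region below it maps to the universal
model of its type, which gives (b).

From right to left: let `K` be any model of `T₁` and `𝒜`. From each individual, `𝒜` is unravelled to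
finite depth into a tree-shaped ABox, and chasing `T₁` from types pulled back from `K` gives a
weakly tree-shaped, finitely branching model that folds into `K`. The query is matched in the chase
of `T₂` over `𝒜` from persistent types, that is, asserted names and names entailed at all copies far
enough from the border of the unravellings. This is a model of `T₂` and `𝒜` (`persist_seed`), and
each of its trees maps to the universal model of a deep enough unravelling. Pieces of the match
inside one tree are carried to `K` by conditions 1 and 2, edges between individuals by the
assumption on role inclusions.

Both directions use one construction, `chase`, of which the universal model is an instance. It is a
model under the conditions `Seed`; functionality holds because a realizable role entails a
functional role only if it equals it (`EntailsRI.eq_of_func`). -/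

namespace HornDL

/-! ### Elementary facts on roles, ABoxes and models -/

section Basics

variable {NC NR NI : Type}

@[simp] theorem Role.inv_inv (r : Role NR) : r.inv.inv = r := by cases r <;> rfl

@[simp] theorem Role.name_inv (r : Role NR) : r.inv.name = r.name := by cases r <;> rfl

theorem Role.inv_ne (r : Role NR) : r.inv ≠ r := by cases r <;> simp [Role.inv]

theorem Role.eq_or_eq_inv_of_name_eq {r s : Role NR} (h : r.name = s.name) :
    r = s ∨ r = s.inv := by
  cases r <;> cases s <;> simp_all [Role.name, Role.inv]

theorem Role.finite_setOf_name_mem {N : Set NR} (hN : N.Finite) :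
    {r : Role NR | r.name ∈ N}.Finite := by
  refine ((hN.image Role.fwd).union (hN.image Role.bwd)).subset ?_
  rintro (r | r) hr
  · exact Or.inl ⟨r, hr, rfl⟩
  · exact Or.inr ⟨r, hr, rfl⟩

instance [Countable NR] : Countable (Role NR) := by
  have : Function.Injective (fun r : Role NR => match r with
      | .fwd p => (Sum.inl p : NR ⊕ NR)
      | .bwd p => Sum.inr p) := by
    rintro (r | r) (s | s) h <;> simp_all
  exact this.countable

@[simp] theorem Interp.ext_inv (I : Interp NC NR NI) (r : Role NR) (d e : I.dom) :
    I.ext r.inv d e ↔ I.ext r e d := by cases r <;> rfl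

@[simp] theorem ABox.hasRole_inv (𝒜 : ABox NC NR NI) (r : Role NR) (a b : NI) :
    𝒜.HasRole r.inv a b ↔ 𝒜.HasRole r b a := by cases r <;> rfl

theorem ABox.HasRole.left_mem {𝒜 : ABox NC NR NI} {r : Role NR} {a b : NI}
    (h : 𝒜.HasRole r a b) : a ∈ 𝒜.ind := by
  cases r with
  | fwd r => exact Or.inr (Or.inl ⟨r, b, h⟩)
  | bwd r => exact Or.inr (Or.inr ⟨r, b, h⟩)

theorem ABox.HasRole.right_mem {𝒜 : ABox NC NR NI} {r : Role NR} {a b : NI}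
    (h : 𝒜.HasRole r a b) : b ∈ 𝒜.ind :=
  ABox.HasRole.left_mem (r := r.inv) ((𝒜.hasRole_inv r b a).2 h)

theorem ABox.ind_finite (𝒜 : ABox NC NR NI) : 𝒜.ind.Finite := by
  classical
  refine ((𝒜.conc.image fun p => p.2) ∪ (𝒜.role.image fun p => p.2.1) ∪
    (𝒜.role.image fun p => p.2.2)).finite_toSet.subset ?_
  rintro a (⟨A, h⟩ | ⟨r, b, h⟩ | ⟨r, b, h⟩)
  · simp only [Finset.coe_union, Finset.coe_image]
    exact Or.inl (Or.inl ⟨_, h, rfl⟩)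
  · simp only [Finset.coe_union, Finset.coe_image]
    exact Or.inl (Or.inr ⟨_, h, rfl⟩)
  · simp only [Finset.coe_union, Finset.coe_image]
    exact Or.inr ⟨_, h, rfl⟩

/-- Every individual of the ABox is an element of every model of the ABox. -/
theorem Interp.ModelsA.exists_nm {I : Interp NC NR NI} {𝒜 : ABox NC NR NI} (h : I.ModelsA 𝒜)
    {a : NI} (ha : a ∈ 𝒜.ind) : ∃ d, I.nm d = some a := by
  rcases ha with ⟨A, hA⟩ | ⟨r, b, hr⟩ | ⟨r, b, hr⟩
  · obtain ⟨d, hd, -⟩ := h.1 A a hA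
    exact ⟨d, hd⟩
  · obtain ⟨d, e, hd, -⟩ := h.2 r a b hr
    exact ⟨d, hd⟩
  · obtain ⟨d, e, -, he, -⟩ := h.2 r b a hr
    exact ⟨e, he⟩

theorem Interp.ModelsA.conc_of_nm {I : Interp NC NR NI} {𝒜 : ABox NC NR NI} (h : I.ModelsA 𝒜)
    {A : NC} {a : NI} (hA : (A, a) ∈ 𝒜.conc) {d : I.dom} (hd : I.nm d = some a) :
    d ∈ I.conc A := by
  obtain ⟨d', hd', hA'⟩ := h.1 A a hA
  rwa [I.nm_inj d d' a hd hd']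

theorem Interp.ModelsA.ext_of_nm {I : Interp NC NR NI} {𝒜 : ABox NC NR NI} (h : I.ModelsA 𝒜)
    {r : Role NR} {a b : NI} (hr : 𝒜.HasRole r a b) {d e : I.dom} (hd : I.nm d = some a)
    (he : I.nm e = some b) : I.ext r d e := by
  cases r with
  | fwd r =>
    obtain ⟨d', e', hd', he', hr'⟩ := h.2 r a b hr
    rw [I.nm_inj d d' a hd hd', I.nm_inj e e' b he he']
    exact hr'
  | bwd r =>
    obtain ⟨e', d', he', hd', hr'⟩ := h.2 r b a hr
    rw [I.nm_inj d d' a hd hd', I.nm_inj e e' b he he']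
    exact hr'

/-- The roles that occur in an axiom. -/
def Ax.roles : Ax NC NR → List (Role NR)
  | .top _ => []
  | .bot _ => []
  | .conj _ _ _ => []
  | .ex _ r _ => [r]
  | .all _ r _ => [r]
  | .ri r s => [r, s]
  | .func r => [r]

/-- The role names that occur in a TBox. -/
def TBox.roleNames (T : TBox NC NR) : Set NR :=
  {p | ∃ α ∈ T.axioms, ∃ r ∈ α.roles, r.name = p}

theorem TBox.roleNames_finite (T : TBox NC NR) : T.roleNames.Finite := by
  classical
  refine (T.axioms.biUnion fun α => (α.roles.map Role.name).toFinset).finite_toSet.subset ?_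
  rintro p ⟨α, hα, r, hr, rfl⟩
  simp only [Finset.coe_biUnion, Set.mem_iUnion]
  exact ⟨α, hα, by simpa using ⟨r, hr, rfl⟩⟩

/-- The same domain with other extensions and names. -/
def Interp.remake (I : Interp NC NR NI) (c : NC → Set I.dom) (ρ : NR → I.dom → I.dom → Prop)
    (n : I.dom → Option NI) (hn : ∀ d e a, n d = some a → n e = some a → d = e) :
    Interp NC NR NI where
  dom := I.dom
  conc := c
  role := ρ
  nm := n
  nm_inj := hn

/-- Names that do not occur in the TBox do not matter for being a model. -/
theorem Interp.ModelsT.remake {T : TBox NC NR} {I : Interp NC NR NI} (hI : I.ModelsT T)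
    {c : NC → Set I.dom} {ρ : NR → I.dom → I.dom → Prop} {n : I.dom → Option NI}
    {hn : ∀ d e a, n d = some a → n e = some a → d = e}
    (hc : ∀ A ∈ T.concNames, c A = I.conc A) (hρ : ∀ p ∈ T.roleNames, ρ p = I.role p) :
    (I.remake c ρ n hn).ModelsT T := by
  refine ⟨hI.1, fun α hα => ?_⟩
  have h := hI.2 α hα
  have hcα : ∀ A ∈ α.concNames, (I.remake c ρ n hn).conc A = I.conc A :=
    fun A hA => hc A ⟨α, hα, hA⟩
  have hrα : ∀ r ∈ α.roles, (I.remake c ρ n hn).ext r = I.ext r := by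
    intro r hr
    have := hρ r.name ⟨α, hα, r, hr, rfl⟩
    cases r with
    | fwd p => exact this
    | bwd p => funext d e; exact congrFun (congrFun this e) d
  cases α with
  | top A =>
    simp only [Sat, hcα A (by simp [Ax.concNames])]
    exact h
  | bot A =>
    simp only [Sat, hcα A (by simp [Ax.concNames])]
    exact h
  | conj A₁ A₂ B =>
    simp only [Sat, hcα A₁ (by simp [Ax.concNames]), hcα A₂ (by simp [Ax.concNames]),
      hcα B (by simp [Ax.concNames])]
    exact h
  | ex A r B =>
    simp only [Sat, hcα A (by simp [Ax.concNames]), hcα B (by simp [Ax.concNames]),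
      hrα r (by simp [Ax.roles])]
    exact h
  | all A r B =>
    simp only [Sat, hcα A (by simp [Ax.concNames]), hcα B (by simp [Ax.concNames]),
      hrα r (by simp [Ax.roles])]
    exact h
  | ri r s =>
    simp only [Sat, hrα r (by simp [Ax.roles]), hrα s (by simp [Ax.roles])]
    exact h
  | func r =>
    simp only [Sat, hrα r (by simp [Ax.roles])]
    exact h

end Basics

/-! ### Entailed role inclusions and functional roles -/

section RoleInclusions

variable {NC NR NI : Type}

/-- The role names that have an explicit subrole, up to inverses. -/
def TBox.superNames (T : TBox NC NR) : Set NR :=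
  {p | ∃ s r, Ax.ri s r ∈ T.axioms ∧ r.name = p}

theorem TBox.superNames_subset (T : TBox NC NR) : T.superNames ⊆ T.roleNames := by
  rintro p ⟨s, r, h, rfl⟩
  exact ⟨_, h, r, by simp [Ax.roles], rfl⟩

theorem TBox.name_notMem_superNames {T : TBox NC NR} {r : Role NR} (h : Ax.func r ∈ T.axioms) :
    r.name ∉ T.superNames := by
  rintro ⟨s, r', hri, hn⟩
  rcases Role.eq_or_eq_inv_of_name_eq hn with rfl | rfl
  · exact (T.noSubrole _ _ hri).1 h
  · exact (T.noSubrole _ _ hri).2 (by simpa using h)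

/-- The role is non-empty in some model of the TBox. -/
def Realizable (NI : Type) (T : TBox NC NR) (s : Role NR) : Prop :=
  ∃ I : Interp NC NR NI, I.ModelsT T ∧ ∃ d e, I.ext s d e

theorem Realizable.inv {T : TBox NC NR} {s : Role NR} (h : Realizable NI T s) :
    Realizable NI T s.inv := by
  obtain ⟨I, hI, d, e, h⟩ := h
  exact ⟨I, hI, e, d, by simpa using h⟩

open Classical in
/-- The displacement of a role in the cover in which the role `s` moves one layer upwards. -/
noncomputable def coverShift (s : Role NR) (r : Role NR) : ℤ :=
  if r = s then 1 else if r = s.inv then -1 else 0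

theorem coverShift_inv (s r : Role NR) : coverShift s r.inv = - coverShift s r := by
  unfold coverShift
  by_cases h₁ : r = s
  · subst h₁
    simp [Role.inv_ne]
  · by_cases h₂ : r = s.inv
    · subst h₂
      simp [Role.inv_ne]
    · have h₃ : r.inv ≠ s := fun h => h₂ (by rw [← h, Role.inv_inv])
      have h₄ : r.inv ≠ s.inv := fun h => h₁ (by rw [← r.inv_inv, h, Role.inv_inv])
      simp [h₁, h₂, h₃, h₄]

/-- A cover of `I` with layers indexed by `ℤ`. The role `s` moves one layer upwards, the other
roles stay in their layer, and roles with explicit subroles connect all layers. -/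
noncomputable def layerCover (T : TBox NC NR) (I : Interp NC NR NI) (s : Role NR) :
    Interp NC NR NI where
  dom := I.dom × ℤ
  conc A := {x | x.1 ∈ I.conc A}
  role p x y := I.role p x.1 y.1 ∧ (p ∈ T.superNames ∨ y.2 = x.2 + coverShift s (.fwd p))
  nm _ := none
  nm_inj _ _ _ h := by cases h

theorem layerCover_ext (T : TBox NC NR) (I : Interp NC NR NI) (s r : Role NR)
    (x y : (layerCover T I s).dom) : (layerCover T I s).ext r x y ↔
      I.ext r x.1 y.1 ∧ (r.name ∈ T.superNames ∨ y.2 = x.2 + coverShift s r) := by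
  cases r with
  | fwd p => rfl
  | bwd p =>
    have h : coverShift s (.bwd p) = - coverShift s (.fwd p) := coverShift_inv s (.fwd p)
    change (I.role p y.1 x.1 ∧ (p ∈ T.superNames ∨ x.2 = y.2 + coverShift s (.fwd p))) ↔
      (I.role p y.1 x.1 ∧ (p ∈ T.superNames ∨ y.2 = x.2 + coverShift s (.bwd p)))
    rw [h]
    refine and_congr_right fun _ => or_congr_right ⟨fun h => ?_, fun h => ?_⟩ <;> omega

/-- An existential witness is placed in the layer dictated by its role. A role with an explicit
subrole joins all layers, so inclusions survive. A functional role has no subrole, even up to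
inverses, so the layer of its successor is determined. -/
theorem layerCover_modelsT {T : TBox NC NR} {I : Interp NC NR NI} (hI : I.ModelsT T)
    (s : Role NR) : (layerCover T I s).ModelsT T := by
  refine ⟨hI.1.elim fun d => ⟨(d, 0)⟩, fun α hα => ?_⟩
  have h := hI.2 α hα
  cases α with
  | top A => exact fun x => h x.1
  | bot A => exact fun x => h x.1
  | conj A₁ A₂ B => exact fun x => h x.1
  | ex A r B =>
    intro x hx
    obtain ⟨e, he, hB⟩ := h x.1 hx
    exact ⟨(e, x.2 + coverShift s r), (layerCover_ext ..).2 ⟨he, Or.inr rfl⟩, hB⟩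
  | all A r B =>
    intro x hx y hy
    exact h x.1 hx y.1 ((layerCover_ext ..).1 hy).1
  | ri r r' =>
    intro x y hxy
    exact (layerCover_ext ..).2 ⟨h x.1 y.1 ((layerCover_ext ..).1 hxy).1, Or.inl ⟨r, r', hα, rfl⟩⟩
  | func r =>
    intro x y y' hy hy'
    obtain ⟨h₁, h₂⟩ := (layerCover_ext ..).1 hy
    obtain ⟨h₁', h₂'⟩ := (layerCover_ext ..).1 hy'
    have hn := T.name_notMem_superNames hα
    exact Prod.ext (h _ _ _ h₁ h₁') ((h₂.resolve_left hn).trans (h₂'.resolve_left hn).symm)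

/-- An entailed inclusion of a realizable role is trivial or leads to a role with an explicit
subrole. -/
theorem EntailsRI.eq_or_mem_superNames {T : TBox NC NR} {s r : Role NR}
    (h : EntailsRI NI T s r) (hs : Realizable NI T s) : s = r ∨ r.name ∈ T.superNames := by
  obtain ⟨I, hI, d, e, hde⟩ := hs
  -- The lifted edge climbs from layer 0 to layer 1. A role other than `s` and outside `superNames`
  -- shifts by 0 or -1, so it cannot contain this edge.
  have := h (layerCover T I s) (layerCover_modelsT hI s) (d, 0) (e, coverShift s s)
    ((layerCover_ext ..).2 ⟨hde, Or.inr (by simp)⟩)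
  rcases ((layerCover_ext ..).1 this).2 with h | h
  · exact Or.inr h
  · left
    by_contra hne
    simp only [coverShift, if_true, zero_add, Ne.symm hne, if_false] at h
    split_ifs at h
    omega

/-- In the chase this reduces the extension of a functional role to the edges labelled with that
very role. -/
theorem EntailsRI.eq_of_func {T : TBox NC NR} {s r : Role NR} (h : EntailsRI NI T s r)
    (hs : Realizable NI T s) (hr : Ax.func r ∈ T.axioms) : s = r :=
  (h.eq_or_mem_superNames hs).resolve_right (T.name_notMem_superNames hr)

theorem EntailsRI.refl (T : TBox NC NR) (r : Role NR) : EntailsRI NI T r r :=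
  fun _ _ _ _ h => h

theorem EntailsRI.inv {T : TBox NC NR} {s r : Role NR} (h : EntailsRI NI T s r) :
    EntailsRI NI T s.inv r.inv := by
  intro I hI d e hde
  simpa using h I hI e d (by simpa using hde)

theorem EntailsRI.trans_ri {T : TBox NC NR} {s r r' : Role NR} (h : EntailsRI NI T s r)
    (h' : Ax.ri r r' ∈ T.axioms) : EntailsRI NI T s r' :=
  fun I hI d e hde => hI.2 _ h' d e (h I hI d e hde)

end RoleInclusions

/-! ### Classes of pointed models and maximal successor types -/

section Classes

variable {NC NR NI : Type}

/-- A class of pointed interpretations. -/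
abbrev PClass (NC NR NI : Type) := (I : Interp NC NR NI) → I.dom → Prop

/-- The concept names that hold throughout the class. -/
def PClass.Lab (𝒞 : PClass NC NR NI) : Set NC := {A | ∀ I d, 𝒞 I d → d ∈ I.conc A}

/-- `∃ r.⨅t` holds throughout the class. -/
def PClass.Ex (𝒞 : PClass NC NR NI) (r : Role NR) (t : Set NC) : Prop :=
  ∀ I d, 𝒞 I d → ∃ e, I.ext r d e ∧ ∀ B ∈ t, e ∈ I.conc B

/-- `t` is a maximal type for which `∃ r.⨅t` holds throughout the class. -/
def PClass.Next (T : TBox NC NR) (𝒞 : PClass NC NR NI) (r : Role NR) (t : Set NC) : Prop :=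
  Maximal (fun t => IsType NI T t ∧ 𝒞.Ex r t) t

/-- The class is non-empty and consists of models of `T`. -/
def PClass.Sound (T : TBox NC NR) (𝒞 : PClass NC NR NI) : Prop :=
  (∃ I d, 𝒞 I d) ∧ ∀ I d, 𝒞 I d → I.ModelsT T

/-- The models of `T` pointed at an instance of `⨅t`. -/
def typeC (NI : Type) (T : TBox NC NR) (t : Set NC) : PClass NC NR NI :=
  fun I d => I.ModelsT T ∧ ∀ B ∈ t, d ∈ I.conc B

/-- The models of `T` and `𝒜` pointed at the individual `a`. -/
def aboxC (T : TBox NC NR) (𝒜 : ABox NC NR NI) (a : NI) : PClass NC NR NI :=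
  fun I d => I.ModelsT T ∧ I.ModelsA 𝒜 ∧ I.nm d = some a

theorem mem_lab_typeC {T : TBox NC NR} {t : Set NC} {A : NC} :
    A ∈ (typeC NI T t).Lab ↔ EntailsSub NI T t A :=
  ⟨fun h I hI d hd => h I d ⟨hI, hd⟩, fun h I d hd => h I hd.1 d hd.2⟩

theorem ex_typeC {T : TBox NC NR} {t : Set NC} {r : Role NR} {t' : Set NC} :
    (typeC NI T t).Ex r t' ↔ EntailsEx NI T t r t' :=
  ⟨fun h I hI d hd => h I d ⟨hI, hd⟩, fun h I d hd => h I hd.1 d hd.2⟩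

theorem subset_lab_typeC {T : TBox NC NR} {t : Set NC} : t ⊆ (typeC NI T t).Lab :=
  fun _ hA _ _ hd => hd.2 _ hA

theorem succ_iff {T : TBox NC NR} {t : Set NC} {r : Role NR} {t' : Set NC} :
    Succ NI T t r t' ↔ IsType NI T t ∧ (typeC NI T t).Next T r t' := by
  simp only [Succ, PClass.Next, ex_typeC]

/-- Concept names that do not occur in `T` do not help to entail existential restrictions. -/
theorem EntailsEx.inter_concNames {T : TBox NC NR} {t : Set NC} {r : Role NR} {t' : Set NC}
    (h : EntailsEx NI T t r t') (ht' : t' ⊆ T.concNames) :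
    EntailsEx NI T (t ∩ T.concNames) r t' := by
  classical
  intro I hI d hd
  -- Names foreign to `T` are made true everywhere: their presence in `t` then costs nothing, and
  -- `t'` contains none of them.
  obtain ⟨e, he, hB⟩ := h
    (I.remake (fun A => if A ∈ T.concNames then I.conc A else Set.univ) I.role I.nm I.nm_inj)
    (hI.remake (fun A hA => if_pos hA) fun _ _ => rfl) d (by
      intro B hB
      change d ∈ (if B ∈ T.concNames then I.conc B else Set.univ)
      split_ifs with hB'
      · exact hd B ⟨hB, hB'⟩
      · trivial)
  refine ⟨e, by cases r <;> exact he, fun B hB' => ?_⟩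
  have : e ∈ (if B ∈ T.concNames then I.conc B else Set.univ) := hB B hB'
  rwa [if_pos (ht' hB')] at this

/-- Emptying the names foreign to `T` keeps a model a model, so none of them follows from `t`.
Satisfiability matters: an unsatisfiable `t` has every name in its closure. -/
theorem IsType.closure {T : TBox NC NR} {t : Set NC} (ht : t ⊆ T.concNames)
    (hsat : (typeC NI T t).Sound T) : IsType NI T (typeC NI T t).Lab := by
  classical
  refine ⟨fun A hA => ?_, fun A hA => ?_⟩
  · obtain ⟨I, d, hI, hd⟩ := hsat.1
    by_contra hn
    have : d ∈ (if A ∈ T.concNames then I.conc A else ∅) := hA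
      (I.remake (fun A => if A ∈ T.concNames then I.conc A else ∅) I.role I.nm I.nm_inj) d
      ⟨hI.remake (fun A hA => if_pos hA) fun _ _ => rfl, fun B hB => by
        change d ∈ (if B ∈ T.concNames then I.conc B else ∅)
        rw [if_pos (ht hB)]
        exact hd B hB⟩
    rw [if_neg hn] at this
    exact this
  · exact fun I d hd => hA I hd.1 d fun B hB => hB I d hd

theorem isTypes_finite (NI : Type) (T : TBox NC NR) : {t | IsType NI T t}.Finite :=
  T.concNames_finite.finite_subsets.subset fun _ h => h.1

theorem typeC_sound_of_mem {T : TBox NC NR} {t : Set NC} {I : Interp NC NR NI}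
    (hI : I.ModelsT T) {d : I.dom} (hd : ∀ B ∈ t, d ∈ I.conc B) : (typeC NI T t).Sound T :=
  ⟨⟨I, d, hI, hd⟩, fun _ _ h => h.1⟩

/-- The witness for `t` also satisfies the closure of `t`, and above this type there is a maximal
one because types are finite in number. -/
theorem PClass.Sound.exists_next {T : TBox NC NR} {𝒞 : PClass NC NR NI} (h𝒞 : 𝒞.Sound T)
    {r : Role NR} {t : Set NC} (ht : t ⊆ T.concNames) (hex : 𝒞.Ex r t) :
    ∃ t', t ⊆ t' ∧ 𝒞.Next T r t' := by
  have hsat : (typeC NI T t).Sound T := by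
    obtain ⟨I, d, hd⟩ := h𝒞.1
    obtain ⟨e, -, he⟩ := hex I d hd
    exact typeC_sound_of_mem (h𝒞.2 I d hd) he
  have hcl : IsType NI T (typeC NI T t).Lab ∧ 𝒞.Ex r (typeC NI T t).Lab := by
    refine ⟨IsType.closure ht hsat, fun I d hd => ?_⟩
    obtain ⟨e, he, hB⟩ := hex I d hd
    exact ⟨e, he, fun B hB' => hB' I e ⟨h𝒞.2 I d hd, hB⟩⟩
  have hfin : {t | IsType NI T t ∧ 𝒞.Ex r t}.Finite :=
    (isTypes_finite NI T).subset fun _ h => h.1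
  obtain ⟨t', h₁, h₂⟩ := hfin.exists_le_maximal hcl
  exact ⟨t', subset_lab_typeC.trans h₁, h₂⟩

/-- The form in which maximality is used: whatever can be demanded of the successor on top of `t` is
already in `t`. -/
theorem PClass.Sound.absorb {T : TBox NC NR} {𝒞 : PClass NC NR NI} (h𝒞 : 𝒞.Sound T)
    {r : Role NR} {t u : Set NC} (ht : 𝒞.Next T r t) (hu : u ⊆ T.concNames)
    (hex : 𝒞.Ex r (t ∪ u)) : u ⊆ t := by
  obtain ⟨t', h₁, h₂⟩ := h𝒞.exists_next (Set.union_subset ht.1.1.1 hu) hex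
  exact Set.subset_union_right.trans
    (h₁.trans (ht.2 h₂.1 (Set.subset_union_left.trans h₁)))

/-- Functionality makes the two witnesses one element, which satisfies `t ∪ u`; each maximal type
then absorbs the other. -/
theorem PClass.Sound.next_unique {T : TBox NC NR} {𝒞 : PClass NC NR NI} (h𝒞 : 𝒞.Sound T)
    {r : Role NR} {t u : Set NC} (hr : Ax.func r ∈ T.axioms) (ht : 𝒞.Next T r t)
    (hu : 𝒞.Next T r u) : t = u := by
  have hex : 𝒞.Ex r (t ∪ u) := by
    intro I d hd
    obtain ⟨e, he, hB⟩ := ht.1.2 I d hd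
    obtain ⟨e', he', hB'⟩ := hu.1.2 I d hd
    obtain rfl := (h𝒞.2 I d hd).2 _ hr d e e' he he'
    exact ⟨e, he, fun B h => h.elim (hB B) (hB' B)⟩
  exact Set.Subset.antisymm (h𝒞.absorb hu ht.1.1.1 (by rwa [Set.union_comm]))
    (h𝒞.absorb ht hu.1.1.1 hex)

theorem PClass.Next.realizable {T : TBox NC NR} {𝒞 : PClass NC NR NI} {r : Role NR} {t : Set NC}
    (h : 𝒞.Next T r t) (h𝒞 : 𝒞.Sound T) : Realizable NI T r := by
  obtain ⟨I, d, hd⟩ := h𝒞.1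
  obtain ⟨e, he, -⟩ := h.1.2 I d hd
  exact ⟨I, h𝒞.2 I d hd, d, e, he⟩

theorem PClass.Next.sound {T : TBox NC NR} {𝒞 : PClass NC NR NI} {r : Role NR} {t : Set NC}
    (h : 𝒞.Next T r t) (h𝒞 : 𝒞.Sound T) : (typeC NI T t).Sound T := by
  obtain ⟨I, d, hd⟩ := h𝒞.1
  obtain ⟨e, -, he⟩ := h.1.2 I d hd
  exact typeC_sound_of_mem (h𝒞.2 I d hd) he

/-- Only roles of `T` lead to successors of a type. -/
theorem PClass.Next.name_mem {T : TBox NC NR} {t : Set NC} {r : Role NR} {t' : Set NC}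
    (h : (typeC NI T t).Next T r t') (hs : (typeC NI T t).Sound T) : r.name ∈ T.roleNames := by
  classical
  obtain ⟨I, d, hI, hd⟩ := hs.1
  -- Erasing the edges of roles foreign to `T` leaves a model with the same concepts, so the
  -- entailed successor is reached by a role of `T`.
  obtain ⟨e, he, -⟩ := h.1.2
    (I.remake I.conc (fun p d e => p ∈ T.roleNames ∧ I.role p d e) I.nm I.nm_inj) d
    ⟨hI.remake (fun _ _ => rfl) fun p hp => by funext d e; simp [hp], hd⟩
  cases r <;> exact he.1

end Classes

/-! ### The chase over classes of individuals -/

section Chase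

variable {NC NR NI : Type}

/-- The individual at which a path starts. -/
def RawPath.root : RawPath NC NR NI → NI
  | .base a => a
  | .snoc π _ _ => π.root

/-- The number of steps of a path. -/
def RawPath.depth : RawPath NC NR NI → ℕ
  | .base _ => 0
  | .snoc π _ _ => π.depth + 1

theorem RawPath.snoc_ne (π : RawPath NC NR NI) (r : Role NR) (t : Set NC) : π.snoc r t ≠ π := by
  intro h
  have := congrArg RawPath.depth h
  simp [RawPath.depth] at this

theorem RawPath.eq_base_of_depth {π : RawPath NC NR NI} (h : π.depth = 0) :
    π = .base π.root := by
  cases π with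
  | base a => rfl
  | snoc π r t => simp [RawPath.depth] at h

theorem RawPath.nm_eq_some {π : RawPath NC NR NI} {a : NI} : π.nm = some a ↔ π = .base a := by
  cases π <;> simp [RawPath.nm]

/-- The class of pointed interpretations attached to a path. -/
def pathClass (T : TBox NC NR) (𝒞 : NI → PClass NC NR NI) : RawPath NC NR NI → PClass NC NR NI
  | .base a => 𝒞 a
  | .snoc _ _ t => typeC NI T t

/-- The path already has a neighbour along the role that is not one of its extensions. -/
def Blocked (𝒜 : ABox NC NR NI) : RawPath NC NR NI → Role NR → Prop
  | .base a, r => ∃ b ∈ 𝒜.ind, 𝒜.HasRole r a b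
  | .snoc _ r' _, r => r' = r.inv

/-- The paths for `𝒜` and `T` when individuals are described by classes. -/
def ChasePath (T : TBox NC NR) (𝒜 : ABox NC NR NI) (𝒞 : NI → PClass NC NR NI) :
    RawPath NC NR NI → Prop
  | .base a => a ∈ 𝒜.ind
  | .snoc π r t => ChasePath T 𝒜 𝒞 π ∧ (pathClass T 𝒞 π).Next T r t ∧
      (Ax.func r ∈ T.axioms → ¬ Blocked 𝒜 π r)

theorem ChasePath.root_mem {T : TBox NC NR} {𝒜 : ABox NC NR NI} {𝒞 : NI → PClass NC NR NI}
    {π : RawPath NC NR NI} (h : ChasePath T 𝒜 𝒞 π) : π.root ∈ 𝒜.ind := by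
  induction π with
  | base a => exact h
  | snoc π r t ih => exact ih h.1

/-- The interpretation on a set of paths in which roles are derived from `𝒜` and from the steps
of the paths. -/
def pathInterp (T : TBox NC NR) (𝒜 : ABox NC NR NI) (P : RawPath NC NR NI → Prop)
    (H : NC → RawPath NC NR NI → Prop) : Interp NC NR NI where
  dom := {π : RawPath NC NR NI // P π}
  conc A := {π | H A π.1}
  role r π π' :=
    (∃ a b s, π.1 = .base a ∧ π'.1 = .base b ∧ 𝒜.HasRole s a b ∧ EntailsRI NI T s (.fwd r)) ∨
    (∃ s t, π'.1 = .snoc π.1 s t ∧ EntailsRI NI T s (.fwd r)) ∨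
    (∃ s t, π.1 = .snoc π'.1 s t ∧ EntailsRI NI T s.inv (.fwd r))
  nm π := π.1.nm
  nm_inj π π' a h h' := Subtype.ext (RawPath.nm_inj π.1 π'.1 a h h')

theorem pathInterp_congr (T : TBox NC NR) (𝒜 : ABox NC NR NI) {P P' : RawPath NC NR NI → Prop}
    {H H' : NC → RawPath NC NR NI → Prop} (hP : ∀ π, P π ↔ P' π)
    (hH : ∀ A π, P π → (H A π ↔ H' A π)) : pathInterp T 𝒜 P H = pathInterp T 𝒜 P' H' := by
  obtain rfl : P = P' := funext fun π => propext (hP π)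
  have : (fun A => {π : {π : RawPath NC NR NI // P π} | H A π.1}) =
      fun A => {π : {π : RawPath NC NR NI // P π} | H' A π.1} := by
    funext A
    ext π
    exact hH A π.1 π.2
  simp only [pathInterp, this]

/-- The interpretation that is generated by `T` from `𝒜` when individuals are described by
classes. -/
def chase (T : TBox NC NR) (𝒜 : ABox NC NR NI) (𝒞 : NI → PClass NC NR NI) : Interp NC NR NI :=
  pathInterp T 𝒜 (ChasePath T 𝒜 𝒞) fun A π => A ∈ (pathClass T 𝒞 π).Lab

/-- The edges from which the roles of `chase` are derived. -/
def PathEdge (𝒜 : ABox NC NR NI) (s : Role NR) (π π' : RawPath NC NR NI) : Prop :=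
  (∃ a b, π = .base a ∧ π' = .base b ∧ 𝒜.HasRole s a b) ∨ (∃ t, π' = .snoc π s t) ∨
    ∃ t, π = .snoc π' s.inv t

theorem PathEdge.symm {𝒜 : ABox NC NR NI} {s : Role NR} {π π' : RawPath NC NR NI}
    (h : PathEdge 𝒜 s π π') : PathEdge 𝒜 s.inv π' π := by
  rcases h with ⟨a, b, h₁, h₂, h⟩ | ⟨t, h⟩ | ⟨t, h⟩
  · exact Or.inl ⟨b, a, h₂, h₁, by simpa using h⟩
  · exact Or.inr (Or.inr ⟨t, by simpa using h⟩)
  · exact Or.inr (Or.inl ⟨t, h⟩)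

theorem PathEdge.depth_le {𝒜 : ABox NC NR NI} {s : Role NR} {π π' : RawPath NC NR NI}
    (h : PathEdge 𝒜 s π π') : π'.depth ≤ π.depth + 1 := by
  rcases h with ⟨a, b, h₁, h₂, h⟩ | ⟨t, h⟩ | ⟨t, h⟩ <;> simp_all [RawPath.depth]; omega

theorem PathEdge.root_eq {𝒜 : ABox NC NR NI} {s : Role NR} {π π' : RawPath NC NR NI}
    (h : PathEdge 𝒜 s π π') (hd : π.depth ≠ 0 ∨ π'.depth ≠ 0) : π'.root = π.root := by
  rcases h with ⟨a, b, h₁, h₂, h⟩ | ⟨t, h⟩ | ⟨t, h⟩ <;> simp_all [RawPath.depth, RawPath.root]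

theorem pathInterp_ext {T : TBox NC NR} {𝒜 : ABox NC NR NI} {P : RawPath NC NR NI → Prop}
    {H : NC → RawPath NC NR NI → Prop} {r : Role NR} {x y : (pathInterp T 𝒜 P H).dom} :
    (pathInterp T 𝒜 P H).ext r x y ↔ ∃ s, PathEdge 𝒜 s x.1 y.1 ∧ EntailsRI NI T s r := by
  have key : ∀ (p : NR) (x y : (pathInterp T 𝒜 P H).dom), (pathInterp T 𝒜 P H).role p x y ↔
      ∃ s, PathEdge 𝒜 s x.1 y.1 ∧ EntailsRI NI T s (.fwd p) := by
    intro p x y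
    constructor
    · rintro (⟨a, b, s, h₁, h₂, h, hs⟩ | ⟨s, t, h, hs⟩ | ⟨s, t, h, hs⟩)
      · exact ⟨s, Or.inl ⟨a, b, h₁, h₂, h⟩, hs⟩
      · exact ⟨s, Or.inr (Or.inl ⟨t, h⟩), hs⟩
      · exact ⟨s.inv, Or.inr (Or.inr ⟨t, by simpa using h⟩), hs⟩
    · rintro ⟨s, ⟨a, b, h₁, h₂, h⟩ | ⟨t, h⟩ | ⟨t, h⟩, hs⟩
      · exact Or.inl ⟨a, b, s, h₁, h₂, h, hs⟩
      · exact Or.inr (Or.inl ⟨s, t, h, hs⟩)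
      · exact Or.inr (Or.inr ⟨s.inv, t, h, by simpa using hs⟩)
  cases r with
  | fwd p => exact key p x y
  | bwd p =>
    refine (key p y x).trans ⟨?_, ?_⟩
    · rintro ⟨s, h, hs⟩
      exact ⟨s.inv, h.symm, hs.inv⟩
    · rintro ⟨s, h, hs⟩
      exact ⟨s.inv, h.symm, hs.inv⟩

theorem chase_ext {T : TBox NC NR} {𝒜 : ABox NC NR NI} {𝒞 : NI → PClass NC NR NI}
    {r : Role NR} {x y : (chase T 𝒜 𝒞).dom} :
    (chase T 𝒜 𝒞).ext r x y ↔ ∃ s, PathEdge 𝒜 s x.1 y.1 ∧ EntailsRI NI T s r :=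
  pathInterp_ext

/-- The conditions on the classes of the individuals under which the chase yields a model. -/
structure Seed (T : TBox NC NR) (𝒜 : ABox NC NR NI) (𝒞 : NI → PClass NC NR NI) : Prop where
  sound : ∀ a ∈ 𝒜.ind, (𝒞 a).Sound T
  conc : ∀ A a, (A, a) ∈ 𝒜.conc → A ∈ (𝒞 a).Lab
  realizable : ∀ s a b, 𝒜.HasRole s a b → Realizable NI T s
  all : ∀ s a b, 𝒜.HasRole s a b → ∀ A r B, Ax.all A r B ∈ T.axioms → EntailsRI NI T s r →
    A ∈ (𝒞 a).Lab → B ∈ (𝒞 b).Lab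
  funcEx : ∀ r a b, Ax.func r ∈ T.axioms → 𝒜.HasRole r a b → ∀ B ∈ T.concNames,
    (𝒞 a).Ex r {B} → B ∈ (𝒞 b).Lab
  func : ∀ r a b b', Ax.func r ∈ T.axioms → 𝒜.HasRole r a b → 𝒜.HasRole r a b' → b = b'

namespace Seed

variable {T : TBox NC NR} {𝒜 : ABox NC NR NI} {𝒞 : NI → PClass NC NR NI}

theorem pathClass_sound (h : Seed T 𝒜 𝒞) {π : RawPath NC NR NI} (hπ : ChasePath T 𝒜 𝒞 π) :
    (pathClass T 𝒞 π).Sound T := by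
  induction π with
  | base a => exact h.sound a hπ
  | snoc π r t ih => exact hπ.2.1.sound (ih hπ.1)

theorem edge_realizable (h : Seed T 𝒜 𝒞) {s : Role NR} {π π' : RawPath NC NR NI}
    (hπ : ChasePath T 𝒜 𝒞 π) (hπ' : ChasePath T 𝒜 𝒞 π') (he : PathEdge 𝒜 s π π') :
    Realizable NI T s := by
  rcases he with ⟨a, b, -, -, hs⟩ | ⟨t, rfl⟩ | ⟨t, rfl⟩
  · exact h.realizable s a b hs
  · exact hπ'.2.1.realizable (h.pathClass_sound hπ)
  · simpa using (hπ.2.1.realizable (h.pathClass_sound hπ')).inv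

/-- Between individuals the seed provides this. Towards a child, `B` holds at the witness in every
model, so the maximal type has absorbed it. From a child to its parent, each instance of the
parent's class has a witness of the child's type, which sends `B` back along the edge. -/
theorem lab_of_all (h : Seed T 𝒜 𝒞) {s : Role NR} {π π' : RawPath NC NR NI}
    (hπ : ChasePath T 𝒜 𝒞 π) (hπ' : ChasePath T 𝒜 𝒞 π') (he : PathEdge 𝒜 s π π')
    {A B : NC} {r : Role NR} (hax : Ax.all A r B ∈ T.axioms) (hs : EntailsRI NI T s r)
    (hA : A ∈ (pathClass T 𝒞 π).Lab) : B ∈ (pathClass T 𝒞 π').Lab := by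
  rcases he with ⟨a, b, rfl, rfl, hab⟩ | ⟨t, rfl⟩ | ⟨t, rfl⟩
  · exact h.all s a b hab A r B hax hs hA
  · have hsound := h.pathClass_sound hπ
    have hB : {B} ⊆ t := by
      refine hsound.absorb hπ'.2.1 ?_ fun I d hd => ?_
      · rintro _ rfl
        exact ⟨_, hax, by simp [Ax.concNames]⟩
      · obtain ⟨e, he, ht⟩ := hπ'.2.1.1.2 I d hd
        refine ⟨e, he, fun C hC => hC.elim (ht C) ?_⟩
        rintro rfl
        have hI := hsound.2 I d hd
        exact hI.2 _ hax d (hA I d hd) e (hs I hI d e he)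
    exact subset_lab_typeC (hB rfl)
  · intro I d hd
    obtain ⟨e, he, ht⟩ := hπ.2.1.1.2 I d hd
    have hI := (h.pathClass_sound hπ').2 I d hd
    exact hI.2 _ hax e (hA I e ⟨hI, ht⟩) d (hs I hI e d (by simpa using he))

/-- `Blocked` forbids a child along a functional role where another neighbour along it exists, and
two children along it have the same type by `PClass.Sound.next_unique`. Between individuals the seed
decides, and the parent is unique. -/
theorem edge_unique (h : Seed T 𝒜 𝒞) {r : Role NR} {π π₁ π₂ : RawPath NC NR NI}
    (hr : Ax.func r ∈ T.axioms) (hπ : ChasePath T 𝒜 𝒞 π) (hπ₁ : ChasePath T 𝒜 𝒞 π₁)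
    (hπ₂ : ChasePath T 𝒜 𝒞 π₂) (h₁ : PathEdge 𝒜 r π π₁) (h₂ : PathEdge 𝒜 r π π₂) :
    π₁ = π₂ := by
  have mixed : ∀ {π' : RawPath NC NR NI} {t : Set NC}, PathEdge 𝒜 r π π' →
      ChasePath T 𝒜 𝒞 (π.snoc r t) → ∃ t', π' = π.snoc r t' := by
    intro π' t he hp
    rcases he with ⟨a, b, rfl, -, hab⟩ | ⟨t, rfl⟩ | ⟨t, rfl⟩
    · exact absurd ⟨b, hab.right_mem, hab⟩ (hp.2.2 hr)
    · exact ⟨t, rfl⟩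
    · exact absurd rfl (hp.2.2 hr)
  have child : ∀ {π₁ π₂ : RawPath NC NR NI} {t : Set NC}, PathEdge 𝒜 r π π₂ →
      ChasePath T 𝒜 𝒞 π₁ → ChasePath T 𝒜 𝒞 π₂ → π₁ = π.snoc r t → π₁ = π₂ := by
    rintro _ π₂ t h₂ hπ₁ hπ₂ rfl
    obtain ⟨t', rfl⟩ := mixed h₂ hπ₁
    rw [(h.pathClass_sound hπ).next_unique hr hπ₁.2.1 hπ₂.2.1]
  rcases h₁ with ⟨a, b, rfl, rfl, hab⟩ | ⟨t, h₁⟩ | ⟨t, rfl⟩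
  · rcases h₂ with ⟨a', b', h, rfl, hab'⟩ | ⟨t, h₂⟩ | ⟨t, h₂⟩
    · cases h
      rw [h.func r a b b' hr hab hab']
    · exact (child (Or.inl ⟨a, b, rfl, rfl, hab⟩) hπ₂ hπ₁ h₂).symm
    · cases h₂
  · exact child h₂ hπ₁ hπ₂ h₁
  · rcases h₂ with ⟨a', b', h, rfl, hab'⟩ | ⟨t', h₂⟩ | ⟨t', h₂⟩
    · cases h
    · exact (child (Or.inr (Or.inr ⟨t, rfl⟩)) hπ₂ hπ₁ h₂).symm
    · cases h₂
      rfl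

/-- If no child may be added, functionality makes the existing neighbour the witness. For an
individual this is `Seed.funcEx`; for a parent, in each model it is the only `r`-successor of the
witness for the child. -/
theorem exists_edge (h : Seed T 𝒜 𝒞) {r : Role NR} {π : RawPath NC NR NI} {B : NC}
    (hπ : ChasePath T 𝒜 𝒞 π) (hB : B ∈ T.concNames) (hex : (pathClass T 𝒞 π).Ex r {B}) :
    ∃ π', ChasePath T 𝒜 𝒞 π' ∧ PathEdge 𝒜 r π π' ∧ B ∈ (pathClass T 𝒞 π').Lab := by
  obtain ⟨t, hBt, hnext⟩ := (h.pathClass_sound hπ).exists_next (by simpa using hB) hex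
  by_cases hbl : Ax.func r ∈ T.axioms → ¬ Blocked 𝒜 π r
  · exact ⟨π.snoc r t, ⟨hπ, hnext, hbl⟩, Or.inr (Or.inl ⟨t, rfl⟩), subset_lab_typeC (hBt rfl)⟩
  · push Not at hbl
    obtain ⟨hr, hbl⟩ := hbl
    cases π with
    | base a =>
      obtain ⟨b, hb, hab⟩ := hbl
      exact ⟨.base b, hb, Or.inl ⟨a, b, rfl, rfl, hab⟩, h.funcEx r a b hr hab B hB hex⟩
    | snoc π r' t' =>
      obtain rfl : r' = r.inv := hbl
      refine ⟨π, hπ.1, Or.inr (Or.inr ⟨t', rfl⟩), fun I d hd => ?_⟩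
      obtain ⟨e, he, ht'⟩ := hπ.2.1.1.2 I d hd
      have hI := (h.pathClass_sound hπ.1).2 I d hd
      obtain ⟨d', hd', hB'⟩ := hex I e ⟨hI, ht'⟩
      obtain rfl := hI.2 _ hr e d d' (by simpa using he) hd'
      exact hB' B rfl

theorem chase_modelsT (h : Seed T 𝒜 𝒞) (hne : 𝒜.ind.Nonempty) : (chase T 𝒜 𝒞).ModelsT T := by
  refine ⟨hne.elim fun a ha => ⟨⟨.base a, ha⟩⟩, fun α hα => ?_⟩
  cases α with
  | top A => exact fun x I d hd => ((h.pathClass_sound x.2).2 I d hd).2 _ hα d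
  | bot A =>
    intro x hx
    obtain ⟨I, d, hd⟩ := (h.pathClass_sound x.2).1
    exact ((h.pathClass_sound x.2).2 I d hd).2 _ hα d (hx I d hd)
  | conj A₁ A₂ B =>
    exact fun x h₁ h₂ I d hd =>
      ((h.pathClass_sound x.2).2 I d hd).2 _ hα d (h₁ I d hd) (h₂ I d hd)
  | ex A r B =>
    intro x hx
    obtain ⟨π', hπ', he, hB⟩ := h.exists_edge x.2 (r := r) (B := B)
      ⟨_, hα, by simp [Ax.concNames]⟩ (by
        intro I d hd
        obtain ⟨e, he, hB⟩ := ((h.pathClass_sound x.2).2 I d hd).2 _ hα d (hx I d hd)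
        exact ⟨e, he, by rintro _ rfl; exact hB⟩)
    exact ⟨⟨π', hπ'⟩, chase_ext.2 ⟨r, he, EntailsRI.refl T r⟩, hB⟩
  | all A r B =>
    intro x hx y hxy
    obtain ⟨s, he, hs⟩ := chase_ext.1 hxy
    exact h.lab_of_all x.2 y.2 he hα hs hx
  | ri r r' =>
    intro x y hxy
    obtain ⟨s, he, hs⟩ := chase_ext.1 hxy
    exact chase_ext.2 ⟨s, he, hs.trans_ri hα⟩
  | func r =>
    intro x y y' hy hy'
    obtain ⟨s, he, hs⟩ := chase_ext.1 hy
    obtain ⟨s', he', hs'⟩ := chase_ext.1 hy'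
    obtain rfl := hs.eq_of_func (h.edge_realizable x.2 y.2 he) hα
    obtain rfl := hs'.eq_of_func (h.edge_realizable x.2 y'.2 he') hα
    exact Subtype.ext (h.edge_unique hα x.2 y.2 y'.2 he he')

theorem chase_modelsA (h : Seed T 𝒜 𝒞) : (chase T 𝒜 𝒞).ModelsA 𝒜 := by
  refine ⟨fun A a hA => ⟨⟨.base a, Or.inl ⟨A, hA⟩⟩, rfl, h.conc A a hA⟩, fun r a b hr => ?_⟩
  have hab : 𝒜.HasRole (.fwd r) a b := hr
  exact ⟨⟨.base a, hab.left_mem⟩, ⟨.base b, hab.right_mem⟩, rfl, rfl,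
    Or.inl ⟨a, b, _, rfl, rfl, hab, EntailsRI.refl T _⟩⟩

end Seed

end Chase

/-! ### The universal model as a chase -/

section UniversalModel

variable {NC NR NI : Type} {T : TBox NC NR} {𝒜 : ABox NC NR NI}

theorem Consistent.seed (h : Consistent T 𝒜) : Seed T 𝒜 (aboxC T 𝒜) := by
  obtain ⟨I, hI, hA⟩ := h
  refine ⟨fun a ha => ⟨?_, fun _ _ h => h.1⟩, fun A a hAa J d hd => hd.2.1.conc_of_nm hAa hd.2.2,
    fun s a b hab => ?_, fun s a b hab A r B hax hs hAa J e he => ?_,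
    fun r a b hr hab B _ hex J e he => ?_, fun r a b b' hr hab hab' => ?_⟩
  · obtain ⟨d, hd⟩ := hA.exists_nm ha
    exact ⟨I, d, hI, hA, hd⟩
  · obtain ⟨d, hd⟩ := hA.exists_nm hab.left_mem
    obtain ⟨e, he⟩ := hA.exists_nm hab.right_mem
    exact ⟨I, hI, d, e, hA.ext_of_nm hab hd he⟩
  · obtain ⟨d, hd⟩ := he.2.1.exists_nm hab.left_mem
    exact he.1.2 _ hax d (hAa J d ⟨he.1, he.2.1, hd⟩) e
      (hs J he.1 d e (he.2.1.ext_of_nm hab hd he.2.2))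
  · obtain ⟨d, hd⟩ := he.2.1.exists_nm hab.left_mem
    obtain ⟨e', he', hB⟩ := hex J d ⟨he.1, he.2.1, hd⟩
    obtain rfl := he.1.2 _ hr d e e' (he.2.1.ext_of_nm hab hd he.2.2) he'
    exact hB B rfl
  · obtain ⟨d, hd⟩ := hA.exists_nm hab.left_mem
    obtain ⟨e, he⟩ := hA.exists_nm hab.right_mem
    obtain ⟨e', he'⟩ := hA.exists_nm hab'.right_mem
    obtain rfl := hI.2 _ hr d e e' (hA.ext_of_nm hab hd he) (hA.ext_of_nm hab' hd he')
    exact Option.some.inj (he.symm.trans he')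

/-- Paths of the universal model are blocked by entailed role assertions, those of the chase by
asserted ones. The two agree because in the chase a functional role gains no edges from other roles.
-/
theorem Consistent.entailsRoleA_iff (h : Consistent T 𝒜) {r : Role NR} {a b : NI}
    (hr : Ax.func r ∈ T.axioms) (ha : a ∈ 𝒜.ind) : EntailsRoleA T 𝒜 r a b ↔ 𝒜.HasRole r a b := by
  constructor
  · intro hab
    obtain ⟨x, y, hx, hy, hxy⟩ := hab _ (h.seed.chase_modelsT ⟨a, ha⟩) h.seed.chase_modelsA
    obtain ⟨s, he, hs⟩ := chase_ext.1 hxy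
    obtain rfl := hs.eq_of_func (h.seed.edge_realizable x.2 y.2 he) hr
    have hx' : x.1 = .base a := RawPath.nm_eq_some.1 hx
    have hy' : y.1 = .base b := RawPath.nm_eq_some.1 hy
    rw [hx', hy'] at he
    rcases he with ⟨_, _, h₁, h₂, h⟩ | ⟨t, h⟩ | ⟨t, h⟩
    · cases h₁
      cases h₂
      exact h
    · cases h
    · cases h
  · intro hab I hI hA
    obtain ⟨d, hd⟩ := hA.exists_nm hab.left_mem
    obtain ⟨e, he⟩ := hA.exists_nm hab.right_mem
    exact ⟨d, e, hd, he, hA.ext_of_nm hab hd he⟩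

theorem ex_aboxC {a : NI} (ha : a ∈ 𝒜.ind) {r : Role NR} {t : Set NC} :
    (aboxC T 𝒜 a).Ex r t ↔ EntailsExA T 𝒜 a r t := by
  constructor
  · intro h I hI hA
    obtain ⟨d, hd⟩ := hA.exists_nm ha
    obtain ⟨e, he⟩ := h I d ⟨hI, hA, hd⟩
    exact ⟨d, e, hd, he⟩
  · intro h I d hd
    obtain ⟨d', e, hd', he⟩ := h I hd.1 hd.2.1
    obtain rfl := I.nm_inj _ _ _ hd' hd.2.2
    exact ⟨e, he⟩

theorem mem_lab_aboxC {a : NI} (ha : a ∈ 𝒜.ind) {A : NC} :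
    A ∈ (aboxC T 𝒜 a).Lab ↔ EntailsConcA T 𝒜 A a := by
  constructor
  · intro h I hI hA
    obtain ⟨d, hd⟩ := hA.exists_nm ha
    exact ⟨d, hd, h I d ⟨hI, hA, hd⟩⟩
  · intro h I d hd
    obtain ⟨d', hd', hA⟩ := h I hd.1 hd.2.1
    obtain rfl := I.nm_inj _ _ _ hd' hd.2.2
    exact hA

theorem Consistent.isPath_iff (h : Consistent T 𝒜) (π : RawPath NC NR NI) :
    IsPath T 𝒜 π ↔ ChasePath T 𝒜 (aboxC T 𝒜) π := by
  induction π with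
  | base a => exact Iff.rfl
  | snoc π r t ih =>
    cases π with
    | base a =>
      simp only [IsPath, ChasePath, pathClass, PClass.Next, SuccA, Blocked]
      refine and_congr_right fun ha => and_congr ?_ (imp_congr_right fun hr => ?_)
      · simp only [ex_aboxC ha]
      · simp only [h.entailsRoleA_iff hr ha]
    | snoc π r' t' =>
      have : IsPath T 𝒜 ((π.snoc r' t').snoc r t) ↔ IsPath T 𝒜 (π.snoc r' t') ∧
          Succ NI T t' r t ∧ (Ax.func r ∈ T.axioms → r' ≠ r.inv) := Iff.rfl
      rw [this, ih, succ_iff]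
      refine and_congr_right fun hπ => and_congr_left fun _ => and_iff_right ?_
      exact hπ.2.1.1.1

/-- The universal model is an instance of the chase. -/
theorem Consistent.univ_eq_chase (h : Consistent T 𝒜) :
    univ T 𝒜 = chase T 𝒜 (aboxC T 𝒜) := by
  refine pathInterp_congr T 𝒜 h.isPath_iff fun A π hπ => ?_
  cases π with
  | base a => exact (mem_lab_aboxC (T := T) (show a ∈ 𝒜.ind from hπ)).symm
  | snoc π r t => exact mem_lab_typeC.symm

theorem Consistent.univ_modelsT (h : Consistent T 𝒜) (hne : 𝒜.ind.Nonempty) :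
    (univ T 𝒜).ModelsT T := by
  rw [h.univ_eq_chase]
  exact h.seed.chase_modelsT hne

theorem Consistent.univ_modelsA (h : Consistent T 𝒜) : (univ T 𝒜).ModelsA 𝒜 := by
  rw [h.univ_eq_chase]
  exact h.seed.chase_modelsA

end UniversalModel

/-! ### Folding a chase into a model -/

section Fold

variable {NC NR NI : Type}

open Classical in
/-- Paths are mapped into `M` step by step, following witnesses where they exist. -/
noncomputable def fold (M : Interp NC NR NI) (m : NI → M.dom) : RawPath NC NR NI → M.dom
  | .base a => m a
  | .snoc π r t =>
    if h : ∃ e, M.ext r (fold M m π) e ∧ ∀ B ∈ t, e ∈ M.conc B then h.choose else fold M m π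

variable {T : TBox NC NR} {𝒜 : ABox NC NR NI} {𝒞 : NI → PClass NC NR NI} {M : Interp NC NR NI}
  {m : NI → M.dom}

/-- Witnesses are demanded only at the image of the root; further down they come from the type
reached before. Hence a single tree can be folded even if the other roots are mapped carelessly. -/
theorem fold_snoc (hM : M.ModelsT T) {π : RawPath NC NR NI} {r : Role NR} {t : Set NC}
    (hp : ChasePath T 𝒜 𝒞 (π.snoc r t)) (hroot : ∀ r t, (𝒞 π.root).Next T r t →
      ∃ e, M.ext r (m π.root) e ∧ ∀ B ∈ t, e ∈ M.conc B) :
    M.ext r (fold M m π) (fold M m (π.snoc r t)) ∧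
      ∀ B ∈ t, fold M m (π.snoc r t) ∈ M.conc B := by
  induction π generalizing r t with
  | base a =>
    have h := hroot r t hp.2.1
    have : fold M m (.snoc (.base a) r t) = h.choose := dif_pos h
    rw [this]
    exact h.choose_spec
  | snoc π r' t' ih =>
    have h := hp.2.1.1.2 M (fold M m (π.snoc r' t')) ⟨hM, (ih hp.1 hroot).2⟩
    have : fold M m ((π.snoc r' t').snoc r t) = h.choose := dif_pos h
    rw [this]
    exact h.choose_spec

theorem fold_conc (hM : M.ModelsT T) {x : (chase T 𝒜 𝒞).dom}
    (hroot : ∀ r t, (𝒞 x.1.root).Next T r t →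
      ∃ e, M.ext r (m x.1.root) e ∧ ∀ B ∈ t, e ∈ M.conc B) (hd : x.1.depth ≠ 0) {A : NC}
    (hA : x ∈ (chase T 𝒜 𝒞).conc A) : fold M m x.1 ∈ M.conc A := by
  obtain ⟨π, hπ⟩ := x
  cases π with
  | base a => exact absurd rfl hd
  | snoc π r t => exact hA M _ ⟨hM, (fold_snoc hM hπ hroot).2⟩

theorem fold_ext (hM : M.ModelsT T) {x y : (chase T 𝒜 𝒞).dom}
    (hroot : ∀ r t, (𝒞 x.1.root).Next T r t →
      ∃ e, M.ext r (m x.1.root) e ∧ ∀ B ∈ t, e ∈ M.conc B)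
    (hd : x.1.depth ≠ 0 ∨ y.1.depth ≠ 0) {r : Role NR} (hxy : (chase T 𝒜 𝒞).ext r x y) :
    M.ext r (fold M m x.1) (fold M m y.1) := by
  obtain ⟨s, he, hs⟩ := chase_ext.1 hxy
  refine hs M hM _ _ ?_
  obtain ⟨x, hx⟩ := x
  obtain ⟨y, hy⟩ := y
  rcases he with ⟨a, b, rfl, rfl, -⟩ | ⟨t, rfl⟩ | ⟨t, rfl⟩
  · simp [RawPath.depth] at hd
  · exact (fold_snoc hM hy hroot).1
  · simpa using (fold_snoc hM hx hroot).1

theorem PClass.Next.exists_of_mem {𝒞₀ : PClass NC NR NI} {d : M.dom} (h : 𝒞₀ M d) :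
    ∀ r t, 𝒞₀.Next T r t → ∃ e, M.ext r d e ∧ ∀ B ∈ t, e ∈ M.conc B :=
  fun _ _ hn => hn.1.2 M d h

/-- The chase maps to every interpretation that belongs to the classes of all individuals. -/
theorem fold_hom (hM : M.ModelsT T) (h : ∀ a ∈ 𝒜.ind, 𝒞 a M (m a))
    (hrole : ∀ s a b, 𝒜.HasRole s a b → M.ext s (m a) (m b)) :
    (∀ A, ∀ x ∈ (chase T 𝒜 𝒞).conc A, fold M m x.1 ∈ M.conc A) ∧
      ∀ r x y, (chase T 𝒜 𝒞).ext r x y → M.ext r (fold M m x.1) (fold M m y.1) := by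
  refine ⟨fun A x hx => ?_, fun r x y hxy => ?_⟩
  · by_cases hd : x.1.depth = 0
    · obtain ⟨π, hπ⟩ := x
      cases π with
      | base a => exact hx M _ (h a hπ)
      | snoc π r t => simp [RawPath.depth] at hd
    · exact fold_conc hM (PClass.Next.exists_of_mem (h _ x.2.root_mem)) hd hx
  · by_cases hd : x.1.depth ≠ 0 ∨ y.1.depth ≠ 0
    · exact fold_ext hM (PClass.Next.exists_of_mem (h _ x.2.root_mem)) hd hxy
    · obtain ⟨s, he, hs⟩ := chase_ext.1 hxy
      refine hs M hM _ _ ?_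
      rcases he with ⟨a, b, hx, hy, hab⟩ | ⟨t, ht⟩ | ⟨t, ht⟩
      · rw [hx, hy]
        exact hrole s a b hab
      · rw [ht] at hd
        simp [RawPath.depth] at hd
      · rw [ht] at hd
        simp [RawPath.depth] at hd

end Fold

/-! ### Seeds pulled back from a model -/

section Pullback

variable {NC NR NI : Type}

/-- Individuals are described by the full type of their images in `K`. -/
def pullC (T : TBox NC NR) (K : Interp NC NR NI) (p : NI → K.dom) (a : NI) : PClass NC NR NI :=
  typeC NI T {A | p a ∈ K.conc A}

theorem pullC_self {T : TBox NC NR} {K : Interp NC NR NI} (hK : K.ModelsT T) (p : NI → K.dom)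
    (a : NI) : pullC T K p a K (p a) :=
  ⟨hK, fun _ h => h⟩

theorem mem_lab_pullC {T : TBox NC NR} {K : Interp NC NR NI} (hK : K.ModelsT T) {p : NI → K.dom}
    {a : NI} {A : NC} : A ∈ (pullC T K p a).Lab ↔ p a ∈ K.conc A :=
  ⟨fun h => h K (p a) (pullC_self hK p a), fun h => subset_lab_typeC h⟩

/-- Every condition on labels can be tested in `K` itself, which realizes the full type of `p a`.
Functionality on `𝒜` is assumed separately because `p` need not be injective, as for unravellings.
-/
theorem Seed.pullback {T : TBox NC NR} {𝒜 : ABox NC NR NI} {K : Interp NC NR NI}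
    (hK : K.ModelsT T) {p : NI → K.dom} (hconc : ∀ A a, (A, a) ∈ 𝒜.conc → p a ∈ K.conc A)
    (hrole : ∀ s a b, 𝒜.HasRole s a b → K.ext s (p a) (p b))
    (hfunc : ∀ r a b b', Ax.func r ∈ T.axioms → 𝒜.HasRole r a b → 𝒜.HasRole r a b' → b = b') :
    Seed T 𝒜 (pullC T K p) where
  sound a _ := ⟨⟨K, p a, pullC_self hK p a⟩, fun _ _ h => h.1⟩
  conc A a h := (mem_lab_pullC hK).2 (hconc A a h)
  realizable s a b h := ⟨K, hK, p a, p b, hrole s a b h⟩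
  all s a b h A r B hax hs hA := (mem_lab_pullC hK).2
    (hK.2 _ hax (p a) ((mem_lab_pullC hK).1 hA) (p b) (hs K hK _ _ (hrole s a b h)))
  funcEx r a b hr h B _ hex := by
    obtain ⟨e, he, hB⟩ := hex K (p a) (pullC_self hK p a)
    obtain rfl := hK.2 _ hr (p a) (p b) e (hrole r a b h) he
    exact (mem_lab_pullC hK).2 (hB B rfl)
  func := hfunc

theorem Interp.ModelsA.hasRole_func {T : TBox NC NR} {𝒜 : ABox NC NR NI} {K : Interp NC NR NI}
    (hA : K.ModelsA 𝒜) (hK : K.ModelsT T) (r : Role NR) (a b b' : NI)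
    (hr : Ax.func r ∈ T.axioms) (hab : 𝒜.HasRole r a b) (hab' : 𝒜.HasRole r a b') : b = b' :=
  (Consistent.seed ⟨K, hK, hA⟩).func r a b b' hr hab hab'

end Pullback

/-! ### Finite branching of the chase -/

section Branching

variable {NC NR NI : Type} {T : TBox NC NR} {𝒜 : ABox NC NR NI}

/-- For classes given by types, successors use only roles of `T` by `PClass.Next.name_mem`. As types
are finite in number, each path has finitely many one-step extensions. -/
theorem Seed.finite_depth_le {τ : NI → Set NC} (h : Seed T 𝒜 fun a => typeC NI T (τ a)) (n : ℕ) :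
    {x : (chase T 𝒜 fun a => typeC NI T (τ a)).dom | x.1.depth ≤ n}.Finite := by
  have key : {π | ChasePath T 𝒜 (fun a => typeC NI T (τ a)) π ∧ π.depth ≤ n}.Finite := by
    induction n with
    | zero =>
      refine (𝒜.ind_finite.image RawPath.base).subset ?_
      rintro π ⟨hπ, hd⟩
      exact ⟨π.root, hπ.root_mem, (RawPath.eq_base_of_depth (Nat.le_zero.1 hd)).symm⟩
    | succ n ih =>
      refine ((𝒜.ind_finite.image RawPath.base).union
        ((ih.prod ((Role.finite_setOf_name_mem T.roleNames_finite).prod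
          (isTypes_finite NI T))).image fun x => RawPath.snoc x.1 x.2.1 x.2.2)).subset ?_
      rintro π ⟨hπ, hd⟩
      cases π with
      | base a => exact Or.inl ⟨a, hπ, rfl⟩
      | snoc π r t =>
        refine Or.inr ⟨(π, r, t), ⟨⟨hπ.1, Nat.le_of_succ_le_succ hd⟩, ?_, hπ.2.1.1.1⟩, rfl⟩
        have hs := h.pathClass_sound hπ.1
        cases π with
        | base a => exact PClass.Next.name_mem hπ.2.1 hs
        | snoc π r' t' => exact PClass.Next.name_mem hπ.2.1 hs
  exact (key.preimage Subtype.val_injective.injOn).subset fun x hx => ⟨x.2, hx⟩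

theorem Interp.exists_ext_of_role {I : Interp NC NR NI} {p : NR} {d e : I.dom}
    (h : I.role p d e ∨ I.role p e d) : ∃ r : Role NR, I.ext r d e ∧ r.name = p :=
  h.elim (fun h => ⟨.fwd p, h, rfl⟩) fun h => ⟨.bwd p, h, rfl⟩

theorem Interp.role_of_ext {I : Interp NC NR NI} {r : Role NR} {d e : I.dom}
    (h : I.ext r d e) : I.role r.name d e ∨ I.role r.name e d := by
  cases r with
  | fwd p => exact Or.inl h
  | bwd p => exact Or.inr h

theorem Seed.chase_finitelyBranching {τ : NI → Set NC}
    (h : Seed T 𝒜 fun a => typeC NI T (τ a)) :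
    (chase T 𝒜 fun a => typeC NI T (τ a)).FinitelyBranching := by
  intro x
  refine (h.finite_depth_le (x.1.depth + 1)).subset ?_
  rintro y ⟨p, hp⟩
  obtain ⟨r, hr, -⟩ := Interp.exists_ext_of_role hp
  obtain ⟨s, he, -⟩ := chase_ext.1 hr
  exact he.depth_le

end Branching

/-! ### Trees from rank functions, and subtrees as components -/

section Trees

/-- On a cycle, a vertex of maximal rank would have two distinct neighbours of smaller rank. -/
theorem isAcyclic_of_rank {V : Type*} (G : SimpleGraph V) (ρ : V → ℕ)
    (hne : ∀ u v, G.Adj u v → ρ u ≠ ρ v)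
    (huniq : ∀ u v w, G.Adj u v → G.Adj u w → ρ v < ρ u → ρ w < ρ u → v = w) :
    G.IsAcyclic := by
  classical
  intro v c hc
  obtain ⟨u, hu, hmax⟩ := c.support.toFinset.exists_max_image ρ ⟨v, by simp⟩
  have hu' : u ∈ c.support := by simpa using hu
  have hrot := hc.rotate hu'
  have hle : ∀ w ∈ (c.rotate u hu').support, ρ w ≤ ρ u := by
    intro w hw
    exact hmax w (by simpa using (c.mem_support_rotate_iff u hu').1 hw)
  have h₁ := (c.rotate u hu').adj_snd hrot.not_nil
  have h₂ := ((c.rotate u hu').adj_penultimate hrot.not_nil).symm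
  refine hrot.snd_ne_penultimate (huniq u _ _ h₁ h₂ ?_ ?_)
  · exact lt_of_le_of_ne (hle _ (SimpleGraph.Walk.getVert_mem_support ..)) (hne _ _ h₁).symm
  · exact lt_of_le_of_ne (hle _ (SimpleGraph.Walk.getVert_mem_support ..)) (hne _ _ h₂).symm

theorem connected_of_rank {V : Type*} (G : SimpleGraph V) (ρ : V → ℕ) (v₀ : V)
    (h : ∀ v, v = v₀ ∨ ∃ u, G.Adj v u ∧ ρ u < ρ v) : G.Connected := by
  have key : ∀ n v, ρ v ≤ n → G.Reachable v v₀ := by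
    intro n
    induction n with
    | zero =>
      intro v hv
      rcases h v with rfl | ⟨u, -, hlt⟩
      · rfl
      · omega
    | succ n ih =>
      intro v hv
      rcases h v with rfl | ⟨u, hadj, hlt⟩
      · rfl
      · exact hadj.reachable.trans (ih u (by omega))
  have : Nonempty V := ⟨v₀⟩
  exact ⟨fun u v => (key _ u le_rfl).trans (key _ v le_rfl).symm⟩

variable {NC NR NI : Type}

theorem Interp.graph_adj {I : Interp NC NR NI} {d e : I.dom} :
    I.graph.Adj d e ↔ d ≠ e ∧ ∃ r : Role NR, I.ext r d e := by
  simp only [Interp.graph, SimpleGraph.fromRel_adj]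
  refine and_congr_right fun _ => ⟨?_, ?_⟩
  · rintro (⟨p, h⟩ | ⟨p, h⟩)
    · exact ⟨.fwd p, h⟩
    · exact ⟨.bwd p, h⟩
  · rintro ⟨p | p, h⟩
    · exact Or.inl ⟨p, h⟩
    · exact Or.inr ⟨p, h⟩

theorem ABox.graph_adj {𝒜 : ABox NC NR NI} {a b : 𝒜.ind} :
    𝒜.graph.Adj a b ↔ a ≠ b ∧ ∃ r : Role NR, 𝒜.HasRole r a.1 b.1 := by
  simp only [ABox.graph, SimpleGraph.fromRel_adj]
  refine and_congr_right fun _ => ⟨?_, ?_⟩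
  · rintro (⟨p, h⟩ | ⟨p, h⟩)
    · exact ⟨.fwd p, h⟩
    · exact ⟨.bwd p, h⟩
  · rintro ⟨p | p, h⟩
    · exact Or.inl ⟨p, h⟩
    · exact Or.inr ⟨p, h⟩

/-- The individuals of the ABox form a tree with root `a₀`, as witnessed by the rank `ρ`. -/
structure ABox.Ranked (𝒜 : ABox NC NR NI) (ρ : NI → ℕ) (a₀ : NI) : Prop where
  ne : ∀ s a b, 𝒜.HasRole s a b → ρ a ≠ ρ b
  unique : ∀ s s' c a b, 𝒜.HasRole s c a → 𝒜.HasRole s' c b → ρ a < ρ c → ρ b < ρ c → a = b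
  root_mem : a₀ ∈ 𝒜.ind
  exists_lower : ∀ c ∈ 𝒜.ind, c = a₀ ∨ ∃ s b, 𝒜.HasRole s c b ∧ ρ b < ρ c

theorem ABox.Ranked.graph_isTree {𝒜 : ABox NC NR NI} {ρ : NI → ℕ} {a₀ : NI}
    (h : 𝒜.Ranked ρ a₀) : 𝒜.graph.IsTree := by
  refine ⟨connected_of_rank _ (fun a => ρ a.1) ⟨a₀, h.root_mem⟩ fun c => ?_,
    isAcyclic_of_rank _ (fun a => ρ a.1) ?_ ?_⟩
  · rcases h.exists_lower c.1 c.2 with hc | ⟨s, b, hb, hlt⟩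
    · exact Or.inl (Subtype.ext hc)
    · refine Or.inr ⟨⟨b, hb.right_mem⟩, ABox.graph_adj.2 ⟨?_, s, hb⟩, hlt⟩
      intro hcb
      rw [hcb] at hlt
      exact lt_irrefl _ hlt
  · intro a b hab
    obtain ⟨-, s, hs⟩ := ABox.graph_adj.1 hab
    exact h.ne s _ _ hs
  · intro c a b ha hb hlt hlt'
    obtain ⟨-, s, hs⟩ := ABox.graph_adj.1 ha
    obtain ⟨-, s', hs'⟩ := ABox.graph_adj.1 hb
    exact Subtype.ext (h.unique s s' _ _ _ hs hs' hlt hlt')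

/-- The rank of the root plus the number of steps. -/
def RawPath.rank (ρ : NI → ℕ) : RawPath NC NR NI → ℕ
  | .base a => ρ a
  | .snoc π _ _ => π.rank ρ + 1

/-- The rank of a path grows by one towards each child, so the only lower neighbour is its parent
or, at an individual, the parent in the ABox. -/
theorem ABox.Ranked.chase_weaklyTreeShaped {T : TBox NC NR} {𝒜 : ABox NC NR NI} {ρ : NI → ℕ}
    {a₀ : NI} (h : 𝒜.Ranked ρ a₀) (𝒞 : NI → PClass NC NR NI) :
    (chase T 𝒜 𝒞).WeaklyTreeShaped := by
  have hrank : ∀ {s : Role NR} {π π' : RawPath NC NR NI}, PathEdge 𝒜 s π π' →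
      π.rank ρ ≠ π'.rank ρ := by
    rintro s π π' (⟨a, b, rfl, rfl, hab⟩ | ⟨t, rfl⟩ | ⟨t, rfl⟩)
    · exact h.ne s a b hab
    · simp [RawPath.rank]
    · simp [RawPath.rank]
  have hadj : ∀ {x y : (chase T 𝒜 𝒞).dom} {s : Role NR}, PathEdge 𝒜 s x.1 y.1 →
      (chase T 𝒜 𝒞).graph.Adj x y := by
    intro x y s he
    refine Interp.graph_adj.2 ⟨?_, s, chase_ext.2 ⟨s, he, EntailsRI.refl T s⟩⟩
    rintro rfl
    exact hrank he rfl
  refine ⟨fun p x hx => ?_, connected_of_rank _ (fun x => x.1.rank ρ) ⟨.base a₀, h.root_mem⟩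
    fun x => ?_, isAcyclic_of_rank _ (fun x => x.1.rank ρ) ?_ ?_⟩
  · obtain ⟨s, he, -⟩ := chase_ext.1 (show (chase T 𝒜 𝒞).ext (.fwd p) x x from hx)
    exact hrank he rfl
  · obtain ⟨π, hπ⟩ := x
    cases π with
    | base c =>
      rcases h.exists_lower c hπ with rfl | ⟨s, b, hb, hlt⟩
      · exact Or.inl rfl
      · exact Or.inr ⟨⟨.base b, hb.right_mem⟩, hadj (Or.inl ⟨c, b, rfl, rfl, hb⟩), hlt⟩
    | snoc π r t =>
      exact Or.inr ⟨⟨π, hπ.1⟩, hadj (s := r.inv) (Or.inr (Or.inr ⟨t, by simp⟩)),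
        Nat.lt_succ_self _⟩
  · intro x y hxy
    obtain ⟨-, r, hr⟩ := Interp.graph_adj.1 hxy
    obtain ⟨s, he, -⟩ := chase_ext.1 hr
    exact hrank he
  · intro x y z hy hz hlt hlt'
    obtain ⟨-, r, hr⟩ := Interp.graph_adj.1 hy
    obtain ⟨s, he, -⟩ := chase_ext.1 hr
    obtain ⟨-, r', hr'⟩ := Interp.graph_adj.1 hz
    obtain ⟨s', he', -⟩ := chase_ext.1 hr'
    obtain ⟨x, hx⟩ := x
    obtain ⟨y, hy⟩ := y
    obtain ⟨z, hz⟩ := z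
    refine Subtype.ext ?_
    change y = z
    rcases he with ⟨a, b, rfl, rfl, hab⟩ | ⟨t, rfl⟩ | ⟨t, rfl⟩
    · rcases he' with ⟨a', b', h₁, rfl, hab'⟩ | ⟨t, rfl⟩ | ⟨t, h₁⟩
      · cases h₁
        rw [h.unique s s' a b b' hab hab' hlt hlt']
      · simp [RawPath.rank] at hlt'
      · cases h₁
    · simp only [RawPath.rank] at hlt
      omega
    · rcases he' with ⟨a', b', h₁, rfl, hab'⟩ | ⟨t, rfl⟩ | ⟨t, h₁⟩
      · cases h₁
      · simp only [RawPath.rank] at hlt'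
        omega
      · injection h₁

theorem Interp.Step.symm {I : Interp NC NR NI} {sg : Sig NC NR} {d e : I.dom}
    (h : I.Step sg d e) : I.Step sg e d := by
  obtain ⟨r, hr, h⟩ := h
  exact ⟨r, hr, h.symm⟩

theorem Interp.reach_symm {I : Interp NC NR NI} {sg : Sig NC NR} {d e : I.dom}
    (h : Relation.ReflTransGen (I.Step sg) d e) : Relation.ReflTransGen (I.Step sg) e d := by
  induction h with
  | refl => exact .refl
  | tail _ h ih => exact .head h.symm ih

/-- A connected component without individuals is a subtree if edges extend paths. -/
theorem Interp.isSubtree_component {I : Interp NC NR NI} {sg : Sig NC NR}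
    (φ : I.dom → RawPath NC NR NI) (hφ : Function.Injective φ)
    (hstep : ∀ r x y, I.nm x = none → I.ext r x y →
      (∃ s t, φ y = (φ x).snoc s t) ∨ ∃ s t, φ x = (φ y).snoc s t)
    (x₀ : I.dom) (hnm : ∀ y, Relation.ReflTransGen (I.Step sg) x₀ y → I.nm y = none) :
    I.IsSubtree sg {y | Relation.ReflTransGen (I.Step sg) x₀ y} := by
  set S : Set I.dom := {y | Relation.ReflTransGen (I.Step sg) x₀ y}
  have hreach : ∀ y (hy : y ∈ S), Relation.ReflTransGen ((I.restrict S).Step sg)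
      ⟨x₀, Relation.ReflTransGen.refl⟩ ⟨y, hy⟩ := by
    intro y hy
    induction hy with
    | refl => exact Relation.ReflTransGen.refl
    | tail h₁ h₂ ih => exact ih.tail h₂
  have hconn : (I.restrict S).Connected sg := fun d e =>
    (Interp.reach_symm (hreach d.1 d.2)).trans (hreach e.1 e.2)
  have hedge : ∀ {x y : (I.restrict S).dom} {r : Role NR}, (I.restrict S).ext r x y →
      (∃ s t, φ y.1 = (φ x.1).snoc s t) ∨ ∃ s t, φ x.1 = (φ y.1).snoc s t := by
    intro x y r hxy
    exact hstep r x.1 y.1 (hnm x.1 x.2) (by cases r <;> exact hxy)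
  have hloop : ∀ {x : (I.restrict S).dom} {r : Role NR}, ¬ (I.restrict S).ext r x x := by
    intro x r hx
    rcases hedge hx with ⟨s, t, h⟩ | ⟨s, t, h⟩ <;> exact RawPath.snoc_ne _ _ _ h.symm
  refine ⟨⟨⟨fun p x hx => hloop (r := .fwd p) hx, ⟨?_, ?_⟩⟩, hconn, hnm⟩, ?_⟩
  · have : Nonempty (I.restrict S).dom := ⟨⟨x₀, Relation.ReflTransGen.refl⟩⟩
    refine ⟨fun x y => ?_⟩
    have hxy := hconn x y
    induction hxy with
    | refl => rfl
    | @tail y z _ h ih =>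
      obtain ⟨p, -, hp⟩ := h
      obtain ⟨r, hr, -⟩ := Interp.exists_ext_of_role hp
      refine ih.trans (SimpleGraph.Adj.reachable (Interp.graph_adj.2 ⟨?_, r, hr⟩))
      rintro rfl
      exact hloop hr
  · refine isAcyclic_of_rank _ (fun x => (φ x.1).depth) ?_ ?_
    · intro x y hxy
      obtain ⟨-, r, hr⟩ := Interp.graph_adj.1 hxy
      rcases hedge hr with ⟨s, t, h⟩ | ⟨s, t, h⟩ <;> simp [h, RawPath.depth]
    · intro x y z hy hz hlt hlt'
      obtain ⟨-, r, hr⟩ := Interp.graph_adj.1 hy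
      obtain ⟨-, r', hr'⟩ := Interp.graph_adj.1 hz
      rcases hedge hr with ⟨s, t, h⟩ | ⟨s, t, h⟩
      · simp only [h, RawPath.depth] at hlt
        omega
      · rcases hedge hr' with ⟨s', t', h'⟩ | ⟨s', t', h'⟩
        · simp only [h', RawPath.depth] at hlt'
          omega
        · rw [h] at h'
          injection h' with h'
          exact Subtype.ext (hφ h')
  -- A larger connected set contains `x₀`, so it stays inside the component.
  · rintro S' ⟨-, hS', -⟩ hle z hz
    have hx₀ : x₀ ∈ S' := hle (Relation.ReflTransGen.refl : x₀ ∈ S)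
    have := hS' ⟨x₀, hx₀⟩ ⟨z, hz⟩
    exact Relation.ReflTransGen.lift (p := I.Step sg) (fun x : (I.restrict S').dom => x.1)
      (fun _ _ h => h) _ _ this

theorem univ_ext {T : TBox NC NR} {𝒜 : ABox NC NR NI} {r : Role NR} {x y : (univ T 𝒜).dom} :
    (univ T 𝒜).ext r x y ↔ ∃ s, PathEdge 𝒜 s x.1 y.1 ∧ EntailsRI NI T s r :=
  pathInterp_ext (P := IsPath T 𝒜) (H := HoldsAt T 𝒜)

theorem univ_isSubtree {T : TBox NC NR} {𝒜 : ABox NC NR NI} {sg : Sig NC NR}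
    (x₀ : (univ T 𝒜).dom)
    (hnm : ∀ y, Relation.ReflTransGen ((univ T 𝒜).Step sg) x₀ y → (univ T 𝒜).nm y = none) :
    (univ T 𝒜).IsSubtree sg {y | Relation.ReflTransGen ((univ T 𝒜).Step sg) x₀ y} := by
  refine Interp.isSubtree_component Subtype.val Subtype.val_injective ?_ x₀ hnm
  intro r x y hx hxy
  obtain ⟨s, ⟨a, b, hx', -, -⟩ | ⟨t, h⟩ | ⟨t, h⟩, -⟩ := univ_ext.1 hxy
  · have h' : (univ T 𝒜).nm x = some a := RawPath.nm_eq_some.2 hx'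
    simp [h'] at hx
  · exact Or.inl ⟨_, _, h⟩
  · exact Or.inr ⟨_, _, h⟩

end Trees

/-! ### Finite parts of the universal model as queries -/

section Queries

variable {NC NR NI : Type}

/-- The query that describes a finite part of an interpretation over finitely many names. -/
theorem exists_query (U : Interp NC NR NI) (sg : Sig NC NR) (X : Finset U.dom) (FC : Finset NC)
    (FR : Finset NR) : ∃ q : CQ NC NR, q.Over sg ∧ ∃ a : Fin q.ans → NI,
      (∀ i, ∃ x ∈ X, U.nm x = some (a i)) ∧ ∀ M : Interp NC NR NI, M.Answers q a ↔
        ∃ h : X → M.dom, (∀ (x : X) b, U.nm x = some b → M.nm (h x) = some b) ∧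
          (∀ A ∈ FC, A ∈ sg.conc → ∀ x : X, x.1 ∈ U.conc A → h x ∈ M.conc A) ∧
          ∀ p ∈ FR, p ∈ sg.role → ∀ x y : X, U.role p x y → M.role p (h x) (h y) := by
  classical
  -- Named elements become answer variables and the others quantified ones. `FC` and `FR` keep the
  -- query finite when the signature is infinite.
  let P : X → Prop := fun x => (U.nm x).isSome
  let e₁ := Fintype.equivFin {x : X // P x}
  let e : X ≃ Fin (Fintype.card {x : X // P x}) ⊕ Fin (Fintype.card {x : X // ¬ P x}) :=
    (Equiv.sumCompl P).symm.trans (Equiv.sumCongr e₁ (Fintype.equivFin {x : X // ¬ P x}))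
  let a : Fin (Fintype.card {x : X // P x}) → NI := fun i =>
    (U.nm (e₁.symm i).1).get (e₁.symm i).2
  have ha : ∀ i, U.nm (e.symm (.inl i)).1 = some (a i) := by
    intro i
    have : e.symm (.inl i) = (e₁.symm i).1 := by simp [e]
    rw [this]
    exact (Option.some_get _).symm
  have he : ∀ (x : X) b, U.nm x = some b → ∃ i, e x = .inl i ∧ a i = b := by
    intro x b hx
    have hP : P x := by simp [P, hx]
    have hex : e x = .inl (e₁ ⟨x, hP⟩) := by
      simp [e, Equiv.sumCompl_symm_apply_of_pos hP]
    refine ⟨_, hex, ?_⟩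
    have := ha (e₁ ⟨x, hP⟩)
    rw [← hex, Equiv.symm_apply_apply, hx] at this
    exact (Option.some.inj this).symm
  refine ⟨⟨_, _, ((FC ×ˢ (Finset.univ : Finset X)).filter fun p =>
      p.1 ∈ sg.conc ∧ p.2.1 ∈ U.conc p.1).toList.map fun p => (p.1, e p.2),
    ((FR ×ˢ (Finset.univ : Finset (X × X))).filter fun p =>
      p.1 ∈ sg.role ∧ U.role p.1 p.2.1 p.2.2).toList.map fun p => (p.1, e p.2.1, e p.2.2)⟩,
    ⟨?_, ?_⟩, a, ?_, ?_⟩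
  · intro p hp
    simp only [List.mem_map, Finset.mem_toList, Finset.mem_filter] at hp
    obtain ⟨p', hp', rfl⟩ := hp
    exact hp'.2.1
  · intro p hp
    simp only [List.mem_map, Finset.mem_toList, Finset.mem_filter] at hp
    obtain ⟨p', hp', rfl⟩ := hp
    exact hp'.2.1
  · exact fun i => ⟨_, (e.symm (.inl i)).2, ha i⟩
  · intro M
    constructor
    · rintro ⟨π, hconc, hrole, hnm⟩
      refine ⟨fun x => π (e x), fun x b hx => ?_, fun A hA hA' x hx => ?_,
        fun p hp hp' x y hxy => ?_⟩
      · obtain ⟨i, hi, rfl⟩ := he x b hx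
        beta_reduce
        rw [hi]
        exact hnm i
      · exact hconc (A, e x) (List.mem_map.2 ⟨(A, x), by simp [hA, hA', hx], rfl⟩)
      · exact hrole (p, e x, e y) (List.mem_map.2 ⟨(p, x, y), by simp [hp, hp', hxy], rfl⟩)
    · rintro ⟨h, hnm, hconc, hrole⟩
      refine ⟨fun v => h (e.symm v), fun p hp => ?_, fun p hp => ?_, fun i => hnm _ _ (ha i)⟩
      · simp only [List.mem_map, Finset.mem_toList, Finset.mem_filter, Finset.mem_product] at hp
        obtain ⟨p', hp', rfl⟩ := hp
        simpa using hconc _ hp'.1.1 hp'.2.1 p'.2 hp'.2.2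
      · simp only [List.mem_map, Finset.mem_toList, Finset.mem_filter, Finset.mem_product] at hp
        obtain ⟨p', hp', rfl⟩ := hp
        simpa using hrole _ hp'.1.1 hp'.2.1 p'.2.1 p'.2.2 hp'.2.2

theorem exists_naming {I : Interp NC NR NI} (hI : Nonempty I.dom) :
    ∃ m : NI → I.dom, ∀ d a, I.nm d = some a → m a = d := by
  classical
  refine ⟨fun a => if h : ∃ d, I.nm d = some a then h.choose else hI.some, fun d a hd => ?_⟩
  have h : ∃ d, I.nm d = some a := ⟨d, hd⟩
  simp only [dif_pos h]
  exact I.nm_inj _ _ a h.choose_spec hd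

/-- The universal model maps to every model. -/
theorem univ_hom {T : TBox NC NR} {𝒜 : ABox NC NR NI} {M : Interp NC NR NI}
    (hM : M.ModelsT T) (hA : M.ModelsA 𝒜) : ∃ h : (univ T 𝒜).dom → M.dom,
      (∀ x b, (univ T 𝒜).nm x = some b → M.nm (h x) = some b) ∧
      (∀ A, ∀ x ∈ (univ T 𝒜).conc A, h x ∈ M.conc A) ∧
      ∀ p x y, (univ T 𝒜).role p x y → M.role p (h x) (h y) := by
  obtain ⟨m, hm⟩ := exists_naming hM.1
  have hm' : ∀ a ∈ 𝒜.ind, M.nm (m a) = some a := by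
    intro a ha
    obtain ⟨d, hd⟩ := hA.exists_nm ha
    rwa [hm d a hd]
  have hc : Consistent T 𝒜 := ⟨M, hM, hA⟩
  rw [hc.univ_eq_chase]
  obtain ⟨h₁, h₂⟩ := fold_hom (𝒞 := aboxC T 𝒜) (𝒜 := 𝒜) hM
    (fun a ha => ⟨hM, hA, hm' a ha⟩) (fun s a b hab =>
      hA.ext_of_nm hab (hm' a hab.left_mem) (hm' b hab.right_mem))
  refine ⟨fun x => fold M m x.1, fun x b hx => ?_, h₁, fun p x y hxy => h₂ (.fwd p) x y hxy⟩
  have hx' : x.1 = .base b := RawPath.nm_eq_some.1 hx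
  have hb : b ∈ 𝒜.ind := by
    have := x.2.root_mem
    rwa [hx'] at this
  change M.nm (fold M m x.1) = some b
  rw [hx']
  exact hm' b hb

/-- Under query entailment, finite parts of the universal model of `T₂` map to the models
of `T₁`. -/
theorem CQEntails.exists_partial_hom {sA sQ : Sig NC NR} {T₁ T₂ : TBox NC NR}
    (h : CQEntails NI sA sQ T₁ T₂) {𝒜 : ABox NC NR NI} (hne : 𝒜.ind.Nonempty) (hov : 𝒜.Over sA)
    (hc₂ : Consistent T₂ 𝒜) {M : Interp NC NR NI} (hM : M.ModelsT T₁) (hMA : M.ModelsA 𝒜)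
    (X : Finset (univ T₂ 𝒜).dom) (FC : Finset NC) (FR : Finset NR) :
    ∃ h : (univ T₂ 𝒜).dom → M.dom,
      (∀ x ∈ X, ∀ b, (univ T₂ 𝒜).nm x = some b → M.nm (h x) = some b) ∧
      (∀ A ∈ FC, A ∈ sQ.conc → ∀ x ∈ X, x ∈ (univ T₂ 𝒜).conc A → h x ∈ M.conc A) ∧
      ∀ p ∈ FR, p ∈ sQ.role → ∀ x ∈ X, ∀ y ∈ X, (univ T₂ 𝒜).role p x y →
        M.role p (h x) (h y) := by
  classical
  obtain ⟨q, hq, a, ha, hans⟩ := exists_query (univ T₂ 𝒜) sQ X FC FR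
  have hcert : CertainAnswer T₂ 𝒜 q a := by
    intro I hI hIA
    obtain ⟨g, h₁, h₂, h₃⟩ := univ_hom hI hIA
    exact (hans I).2 ⟨fun x => g x, fun x b => h₁ x b, fun A _ _ x => h₂ A x,
      fun p _ _ x y => h₃ p x y⟩
  have hind : ∀ i, a i ∈ 𝒜.ind := by
    intro i
    obtain ⟨x, -, hx⟩ := ha i
    have hx' : x.1 = .base (a i) := RawPath.nm_eq_some.1 hx
    have := x.2
    rwa [hx'] at this
  obtain ⟨g, h₁, h₂, h₃⟩ := (hans M).1
    (h 𝒜 hne hov ⟨M, hM, hMA⟩ hc₂ q hq a hind hcert M hM hMA)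
  refine ⟨fun x => if hx : x ∈ X then g ⟨x, hx⟩ else hM.1.some, fun x hx b hb => ?_,
    fun A hA hA' x hx hxA => ?_, fun p hp hp' x hx y hy hxy => ?_⟩
  · simpa only [dif_pos hx] using h₁ ⟨x, hx⟩ b hb
  · simpa only [dif_pos hx] using h₂ A hA hA' ⟨x, hx⟩ hxA
  · simpa only [dif_pos hx, dif_pos hy] using h₃ p hp hp' ⟨x, hx⟩ ⟨y, hy⟩ hxy

end Queries

/-! ### Limits of partial homomorphisms -/

section Compactness

open Filter

variable {NC NR NI ι : Type} {U M : Interp NC NR NI} {sg : Sig NC NR}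

/-- Along an ultrafilter, images confined to a finite set are eventually constant. An atom holds for
the limit values because some index has these values and satisfies the atom. -/
theorem Interp.homTo_of_eventually (l : Filter ι) [l.NeBot] (S : Set U.dom)
    (h : ι → U.dom → M.dom) (hfin : ∀ x ∈ S, ∃ F : Set M.dom, F.Finite ∧ ∀ᶠ i in l, h i x ∈ F)
    (hnm : ∀ x ∈ S, ∀ b, U.nm x = some b → ∀ᶠ i in l, M.nm (h i x) = some b)
    (hconc : ∀ A ∈ sg.conc, ∀ x ∈ S, x ∈ U.conc A → ∀ᶠ i in l, h i x ∈ M.conc A)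
    (hrole : ∀ p ∈ sg.role, ∀ x y, U.role p x y → ∀ᶠ i in l, M.role p (h i x) (h i y)) :
    (U.restrict S).HomTo sg M := by
  have hle := Ultrafilter.of_le l
  have hval : ∀ x : S, ∃ v, ∀ᶠ i in (Ultrafilter.of l : Filter ι), h i x = v := by
    intro x
    obtain ⟨F, hF, hev⟩ := hfin x.1 x.2
    have : ∀ᶠ i in (Ultrafilter.of l : Filter ι), ∃ v ∈ F, h i x = v :=
      (hev.filter_mono hle).mono fun i hi => ⟨_, hi, rfl⟩
    obtain ⟨v, -, hv⟩ := (Ultrafilter.eventually_exists_mem_iff hF).1 this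
    exact ⟨v, hv⟩
  choose g hg using hval
  refine ⟨g, fun x b hx => ?_, fun A hA x hx => ?_, fun p hp x y hxy => ?_⟩
  · obtain ⟨i, h₁, h₂⟩ := ((hg x).and ((hnm x.1 x.2 b hx).filter_mono hle)).exists
    rwa [← h₁]
  · obtain ⟨i, h₁, h₂⟩ := ((hg x).and ((hconc A hA x.1 x.2 hx).filter_mono hle)).exists
    rwa [← h₁]
  · obtain ⟨i, h₁, h₂, h₃⟩ :=
      ((hg x).and ((hg y).and ((hrole p hp x.1 y.1 hxy).filter_mono hle))).exists
    rwa [← h₁, ← h₂]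

/-- Confinement to finite sets spreads along steps, hence from one point to everything reachable
from it. -/
theorem Interp.FinitelyBranching.eventually_mem (hM : M.FinitelyBranching) {l : Filter ι}
    {h : ι → U.dom → M.dom}
    (hrole : ∀ p ∈ sg.role, ∀ x y, U.role p x y → ∀ᶠ i in l, M.role p (h i x) (h i y))
    {x y : U.dom} (hxy : U.Step sg x y) (hx : ∃ F : Set M.dom, F.Finite ∧ ∀ᶠ i in l, h i x ∈ F) :
    ∃ F : Set M.dom, F.Finite ∧ ∀ᶠ i in l, h i y ∈ F := by
  obtain ⟨F, hF, hev⟩ := hx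
  refine ⟨⋃ d ∈ F, {e | ∃ r, M.role r d e ∨ M.role r e d}, hF.biUnion fun d _ => hM d, ?_⟩
  obtain ⟨p, hp, hr | hr⟩ := hxy
  · filter_upwards [hev, hrole p hp x y hr] with i h₁ h₂
    exact Set.mem_biUnion h₁ ⟨p, Or.inl h₂⟩
  · filter_upwards [hev, hrole p hp y x hr] with i h₁ h₂
    exact Set.mem_biUnion h₁ ⟨p, Or.inr h₂⟩

end Compactness

/-! ### Universal models of types -/

section TypeModels

variable {NC NR NI : Type} {T : TBox NC NR}

theorem Interp.mem_tp {I : Interp NC NR NI} {d : I.dom} {A : NC} :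
    A ∈ I.tp T d ↔ A ∈ T.concNames ∧ d ∈ I.conc A := by
  simp [Interp.tp]

/-- The class of an element does not change if names outside `T` are forgotten. -/
theorem PClass.Next.entailsEx_tp {I : Interp NC NR NI} {d : I.dom} {r : Role NR} {t : Set NC}
    (h : (typeC NI T {A | d ∈ I.conc A}).Next T r t) :
    EntailsEx NI T (I.tp T d : Set NC) r t := by
  have := (ex_typeC.1 h.1.2).inter_concNames h.1.1.1
  convert this using 1
  ext A
  simp [Interp.mem_tp, and_comm]

/-- If no concept name of `T` holds at some element of a model, then a single element without
concepts and roles is a model. -/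
theorem tp_nonempty_of_entailsEx {I : Interp NC NR NI} (hI : I.ModelsT T) {d : I.dom}
    {r : Role NR} {t : Set NC} (h : EntailsEx NI T (I.tp T d : Set NC) r t) :
    (I.tp T d).Nonempty := by
  by_contra hemp
  rw [Finset.not_nonempty_iff_eq_empty] at hemp
  let J : Interp NC NR NI := ⟨Unit, fun _ => ∅, fun _ _ _ => False, fun _ => none,
    fun _ _ _ h => by cases h⟩
  have hext : ∀ r d e, ¬ J.ext r d e := by
    intro r d e h
    cases r <;> exact h
  have hJ : J.ModelsT T := by
    refine ⟨⟨()⟩, fun α hα => ?_⟩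
    cases α with
    | top A =>
      have : A ∈ I.tp T d := Interp.mem_tp.2 ⟨⟨_, hα, by simp [Ax.concNames]⟩, hI.2 _ hα d⟩
      simp [hemp] at this
    | bot A => exact fun _ h => h
    | conj A₁ A₂ B => exact fun _ h => absurd h (Set.notMem_empty _)
    | ex A r B => exact fun _ h => absurd h (Set.notMem_empty _)
    | all A r B => exact fun _ h => absurd h (Set.notMem_empty _)
    | ri r s => exact fun d e h => absurd h (hext r d e)
    | func r => exact fun d e _ h => absurd h (hext r d e)
  obtain ⟨e, he, -⟩ := h J hJ () (by simp [hemp])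
  exact hext r _ _ he

variable [Nonempty NI]

theorem typeABox_ind {t : Finset NC} (ht : t.Nonempty) :
    Classical.arbitrary NI ∈ (typeABox t : ABox NC NR NI).ind := by
  obtain ⟨A, hA⟩ := ht
  exact Or.inl ⟨A, by simp [typeABox, hA]⟩

/-- A model pointed at an element with all concepts of `t` can be seen as a model of the ABox
for `t`. -/
theorem aboxC_typeABox {M : Interp NC NR NI} (hM : M.ModelsT T) {t : Finset NC} {e : M.dom}
    (he : ∀ B ∈ t, e ∈ M.conc B) : ∃ hn, aboxC T (typeABox t) (Classical.arbitrary NI)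
      (M.remake M.conc M.role
        (open Classical in fun d => if d = e then some (Classical.arbitrary NI) else none) hn) e := by
  classical
  refine ⟨?_, hM.remake (fun _ _ => rfl) fun _ _ => rfl, ⟨?_, ?_⟩, ?_⟩
  · intro d d' a hd hd'
    split_ifs at hd hd' with h h'
    exact h.trans h'.symm
  · intro A a hA
    simp only [typeABox, Finset.mem_product, Finset.mem_singleton] at hA
    refine ⟨e, ?_, he A hA.1⟩
    simp [Interp.remake, hA.2]
  · intro r a b h
    simp [typeABox] at h
  · simp [Interp.remake]

theorem consistent_typeABox {M : Interp NC NR NI} (hM : M.ModelsT T) {t : Finset NC} {e : M.dom}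
    (he : ∀ B ∈ t, e ∈ M.conc B) : Consistent T (typeABox t : ABox NC NR NI) := by
  obtain ⟨hn, h⟩ := aboxC_typeABox hM he
  exact ⟨_, h.1, h.2.1⟩

/-- The universal model of a type maps to every model with an instance of the type. -/
theorem univType_hom {M : Interp NC NR NI} (hM : M.ModelsT T) {t : Finset NC} {e : M.dom}
    (he : ∀ B ∈ t, e ∈ M.conc B) : ∃ h : (univType NI T t).dom → M.dom,
      (∀ A, ∀ x ∈ (univType NI T t).conc A, h x ∈ M.conc A) ∧
      ∀ p x y, (univType NI T t).role p x y → M.role p (h x) (h y) := by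
  obtain ⟨hn, h⟩ := aboxC_typeABox hM he
  obtain ⟨g, -, h₂, h₃⟩ := univ_hom h.1 h.2.1
  exact ⟨g, h₂, h₃⟩

theorem univType_root {I : Interp NC NR NI} (hI : I.ModelsT T) {d : I.dom}
    (hne : (I.tp T d).Nonempty) : (univType NI T (I.tp T d)).ModelsT T ∧
      ∃ x : (univType NI T (I.tp T d)).dom, ∀ B ∈ I.tp T d,
        x ∈ (univType NI T (I.tp T d)).conc B := by
  have hc : Consistent T (typeABox (I.tp T d) : ABox NC NR NI) :=
    consistent_typeABox hI fun B hB => (Interp.mem_tp.1 hB).2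
  refine ⟨hc.univ_modelsT ⟨_, typeABox_ind hne⟩, ⟨.base (Classical.arbitrary NI),
    typeABox_ind hne⟩, fun B hB J hJ hJA => ?_⟩
  exact hJA.1 B _ (by simp [typeABox, hB])

end TypeModels

/-! ### From query entailment to homomorphisms -/

section Forward

open Filter

variable {NC NR NI : Type}

/-- A family of maps that are eventually homomorphic on all atoms over the signature. -/
theorem CQEntails.exists_family {sA sQ : Sig NC NR} {T₁ T₂ : TBox NC NR}
    (h : CQEntails NI sA sQ T₁ T₂) {𝒜 : ABox NC NR NI} (hne : 𝒜.ind.Nonempty) (hov : 𝒜.Over sA)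
    (hc₂ : Consistent T₂ 𝒜) {M : Interp NC NR NI} (hM : M.ModelsT T₁) (hMA : M.ModelsA 𝒜) :
    ∃ g : Finset (univ T₂ 𝒜).dom × Finset NC × Finset NR → (univ T₂ 𝒜).dom → M.dom,
      (∀ x b, (univ T₂ 𝒜).nm x = some b → ∀ᶠ i in atTop, M.nm (g i x) = some b) ∧
      (∀ A ∈ sQ.conc, ∀ x, x ∈ (univ T₂ 𝒜).conc A → ∀ᶠ i in atTop, g i x ∈ M.conc A) ∧
      ∀ p ∈ sQ.role, ∀ x y, (univ T₂ 𝒜).role p x y →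
        ∀ᶠ i in atTop, M.role p (g i x) (g i y) := by
  classical
  choose g h₁ h₂ h₃ using fun i : Finset (univ T₂ 𝒜).dom × Finset NC × Finset NR =>
    h.exists_partial_hom hne hov hc₂ hM hMA i.1 i.2.1 i.2.2
  -- An atom is preserved from the index that contains its elements and its name onwards.
  refine ⟨g, fun x b hx => ?_, fun A hA x hx => ?_, fun p hp x y hxy => ?_⟩
  · filter_upwards [eventually_ge_atTop (({x}, ∅, ∅) : Finset (univ T₂ 𝒜).dom × _ × _)] with i hi
    exact h₁ i x (hi.1 (by simp)) b hx
  · filter_upwards [eventually_ge_atTop (({x}, {A}, ∅) : Finset (univ T₂ 𝒜).dom × _ × _)] with i hi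
    exact h₂ i A (hi.2.1 (by simp)) hA x (hi.1 (by simp)) hx
  · filter_upwards [eventually_ge_atTop (({x, y}, ∅, {p}) : Finset (univ T₂ 𝒜).dom × _ × _)]
      with i hi
    exact h₃ i p (hi.2.2 (by simp)) hp x (hi.1 (by simp)) y (hi.1 (by simp)) hxy

/-- Individuals have fixed images, and finite branching of `M` then confines the images of all
elements reachable from them. -/
theorem CQEntails.con_homTo {sA sQ : Sig NC NR} {T₁ T₂ : TBox NC NR}
    (h : CQEntails NI sA sQ T₁ T₂) {𝒜 : ABox NC NR NI} (hne : 𝒜.ind.Nonempty) (hov : 𝒜.Over sA)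
    (hc₂ : Consistent T₂ 𝒜) {M : Interp NC NR NI} (hfb : M.FinitelyBranching)
    (hM : M.ModelsT T₁) (hMA : M.ModelsA 𝒜) : ((univ T₂ 𝒜).con sQ).HomTo sQ M := by
  classical
  obtain ⟨g, h₁, h₂, h₃⟩ := h.exists_family hne hov hc₂ hM hMA
  refine Interp.homTo_of_eventually atTop _ g ?_ (fun x _ => h₁ x) (fun A hA x _ => h₂ A hA x) h₃
  rintro x ⟨c, a, hc, hcx⟩
  induction hcx with
  | refl =>
    refine ⟨{d | M.nm d = some a}, Set.Subsingleton.finite fun d hd e he => ?_, h₁ c a hc⟩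
    exact M.nm_inj d e a hd he
  | tail _ hstep ih => exact hfb.eventually_mem h₃ hstep ih

/-- The name of the last role of a path. -/
def RawPath.lastName : RawPath NC NR NI → Option NR
  | .base _ => none
  | .snoc _ r _ => some r.name

/-- Only finitely many names matter on a finite set of elements that are not individuals. -/
theorem Consistent.finite_names {T : TBox NC NR} {𝒜 : ABox NC NR NI} (hc : Consistent T 𝒜)
    {Y : Set (univ T 𝒜).dom} (hY : Y.Finite) (hnm : ∀ x ∈ Y, (univ T 𝒜).nm x = none) :
    (∀ A, ∀ x ∈ Y, x ∈ (univ T 𝒜).conc A → A ∈ T.concNames) ∧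
      {p | ∃ x ∈ Y, ∃ y ∈ Y, (univ T 𝒜).role p x y}.Finite := by
  constructor
  · rintro A ⟨π, hπ⟩ hx hA
    cases π with
    | base a => exact absurd (hnm _ hx) (by simp [univ, RawPath.nm])
    | snoc π r t =>
      have ht := ((hc.isPath_iff _).1 hπ).2.1.1.1
      exact ht.1 (ht.2 A hA)
  · have hfin : {p | ∃ x ∈ Y, x.1.lastName = some p}.Finite :=
      ((hY.image fun x => x.1.lastName).preimage (Option.some_injective NR).injOn).subset
        fun p ⟨x, hx, hp⟩ => ⟨x, hx, hp⟩
    -- A role name between two elements that are not individuals either has an explicit subrole, up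
    -- to inverses, or is the name of the last role of one of them.
    refine ((T.roleNames_finite.subset T.superNames_subset).union hfin).subset ?_
    rintro p ⟨x, hx, y, hy, hxy⟩
    obtain ⟨s, he, hs⟩ := univ_ext.1 (show (univ T 𝒜).ext (.fwd p) x y from hxy)
    have hreal := hc.seed.edge_realizable ((hc.isPath_iff _).1 x.2) ((hc.isPath_iff _).1 y.2) he
    rcases hs.eq_or_mem_superNames hreal with rfl | hp
    · right
      rcases he with ⟨a, b, hx', -, -⟩ | ⟨t, ht⟩ | ⟨t, ht⟩
      · have : (univ T 𝒜).nm x = some a := RawPath.nm_eq_some.2 hx'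
        simp [hnm x hx] at this
      · exact ⟨y, hy, by rw [ht]; rfl⟩
      · exact ⟨x, hx, by rw [ht]; rfl⟩
    · exact Or.inl hp

/-- The part of the chase strictly below an individual maps to the universal model of the type of
that individual. -/
theorem exists_hom_below [Nonempty NI] {T : TBox NC NR} {𝒜 : ABox NC NR NI}
    {I : Interp NC NR NI} (hI : I.ModelsT T) (m : NI → I.dom) (a : NI)
    (hne : ∃ x : (chase T 𝒜 (pullC T I m)).dom, x.1.root = a ∧ 0 < x.1.depth) :
    ∃ f : (chase T 𝒜 (pullC T I m)).dom → (univType NI T (I.tp T (m a))).dom,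
      (∀ A x, x.1.root = a → 0 < x.1.depth → x ∈ (chase T 𝒜 (pullC T I m)).conc A →
        f x ∈ (univType NI T (I.tp T (m a))).conc A) ∧
      ∀ p x y, x.1.root = a → 0 < x.1.depth → (chase T 𝒜 (pullC T I m)).role p x y →
        (univType NI T (I.tp T (m a))).role p (f x) (f y) := by
  have hstep : ∃ r t, (pullC T I m a).Next T r t := by
    obtain ⟨⟨π, hπ⟩, hroot, hdepth⟩ := hne
    induction π with
    | base b => simp [RawPath.depth] at hdepth
    | snoc π r t ih =>
      cases π with
      | base b =>
        obtain rfl : b = a := hroot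
        exact ⟨r, t, hπ.2.1⟩
      | snoc π r' t' => exact ih hπ.1 hroot (Nat.succ_pos _)
  obtain ⟨r, t, hrt⟩ := hstep
  -- The universal model of an empty type has no elements. This case is excluded because the type of
  -- `m a` entails a successor.
  obtain ⟨hM, x₀, hx₀⟩ := univType_root hI
    (tp_nonempty_of_entailsEx hI (PClass.Next.entailsEx_tp hrt))
  have hroot : ∀ x : (chase T 𝒜 (pullC T I m)).dom, x.1.root = a →
      ∀ r t, (pullC T I m x.1.root).Next T r t →
        ∃ e, (univType NI T (I.tp T (m a))).ext r x₀ e ∧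
          ∀ B ∈ t, e ∈ (univType NI T (I.tp T (m a))).conc B := by
    intro x hx r t hrt
    rw [hx] at hrt
    exact (PClass.Next.entailsEx_tp hrt) _ hM x₀ hx₀
  refine ⟨fun x => fold _ (fun _ => x₀) x.1, fun A x hx hd hA => ?_, fun p x y hx hd hxy => ?_⟩
  · exact fold_conc hM (hroot x hx) hd.ne' hA
  · exact fold_ext hM (hroot x hx) (Or.inl hd.ne') (r := .fwd p) hxy

/-- The target `I` is replaced by the chase of `T₁` from the types in `I`, which folds into `I` and
is finitely branching for every `I`. The dichotomy is whether the images of one point `x₀` of the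
subtree return to some bounded depth or drift to infinity. -/
theorem CQEntails.subtree_homTo [Nonempty NI] {sA sQ : Sig NC NR} {T₁ T₂ : TBox NC NR}
    (h : CQEntails NI sA sQ T₁ T₂) {𝒜 : ABox NC NR NI} (hne : 𝒜.ind.Nonempty) (hov : 𝒜.Over sA)
    (hc₂ : Consistent T₂ 𝒜) {I : Interp NC NR NI} (hI : I.ModelsT T₁) (hIA : I.ModelsA 𝒜)
    {S : Set (univ T₂ 𝒜).dom} (hS : (univ T₂ 𝒜).IsSubtree sQ S) :
    ((univ T₂ 𝒜).restrict S).HomTo sQ I ∨ ∃ a ∈ 𝒜.ind, ∃ d : I.dom, I.nm d = some a ∧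
      ((univ T₂ 𝒜).restrict S).FinHomTo sQ (univType NI T₁ (I.tp T₁ d)) := by
  classical
  obtain ⟨m, hm⟩ := exists_naming hI.1
  have hm' : ∀ a ∈ 𝒜.ind, I.nm (m a) = some a := by
    intro a ha
    obtain ⟨d, hd⟩ := hIA.exists_nm ha
    rwa [hm d a hd]
  have hmrole : ∀ s a b, 𝒜.HasRole s a b → I.ext s (m a) (m b) := fun s a b hab =>
    hIA.ext_of_nm hab (hm' a hab.left_mem) (hm' b hab.right_mem)
  have hseed : Seed T₁ 𝒜 (pullC T₁ I m) := Seed.pullback hI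
    (fun A a hA => hIA.conc_of_nm hA (hm' a (Or.inl ⟨A, hA⟩))) hmrole (hIA.hasRole_func hI)
  obtain ⟨g, -, h₂, h₃⟩ := h.exists_family hne hov hc₂ (hseed.chase_modelsT hne)
    hseed.chase_modelsA
  obtain ⟨⟨⟨-, htree⟩, hconn, hnm⟩, -⟩ := hS
  obtain ⟨⟨x₀, hx₀⟩⟩ := htree.1.nonempty
  by_cases hcase : ∃ n, ∃ᶠ i in atTop, (g i x₀).1.depth ≤ n
  · left
    obtain ⟨n, hn⟩ := hcase
    -- Restricted to the indices of bounded depth, the images of `x₀` lie in a finite set, and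
    -- connectedness spreads this to the subtree.
    have : NeBot (atTop ⊓ 𝓟 {i | (g i x₀).1.depth ≤ n}) := frequently_mem_iff_neBot.1 hn
    have h₃' : ∀ p ∈ sQ.role, ∀ x y, (univ T₂ 𝒜).role p x y →
        ∀ᶠ i in atTop ⊓ 𝓟 {i | (g i x₀).1.depth ≤ n},
          (chase T₁ 𝒜 (pullC T₁ I m)).role p (g i x) (g i y) :=
      fun p hp x y hxy => (h₃ p hp x y hxy).filter_mono inf_le_left
    have hhom : ((univ T₂ 𝒜).restrict S).HomTo sQ (chase T₁ 𝒜 (pullC T₁ I m)) := by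
      refine Interp.homTo_of_eventually (atTop ⊓ 𝓟 {i | (g i x₀).1.depth ≤ n}) S g ?_
        (fun x hx b hb => ?_) (fun A hA x _ hx => (h₂ A hA x hx).filter_mono inf_le_left) h₃'
      · intro x hx
        have : ∀ y, Relation.ReflTransGen (((univ T₂ 𝒜).restrict S).Step sQ) ⟨x₀, hx₀⟩ y →
            ∃ F : Set (chase T₁ 𝒜 (pullC T₁ I m)).dom, F.Finite ∧
              ∀ᶠ i in atTop ⊓ 𝓟 {i | (g i x₀).1.depth ≤ n}, g i y.1 ∈ F := by
          intro y hy
          induction hy with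
          | refl =>
            exact ⟨_, Seed.finite_depth_le (τ := fun a => {A | m a ∈ I.conc A}) hseed n,
              mem_inf_of_right (mem_principal_self _)⟩
          | tail _ hstep ih =>
            exact (Seed.chase_finitelyBranching (τ := fun a => {A | m a ∈ I.conc A})
              hseed).eventually_mem h₃' hstep ih
        exact this ⟨x, hx⟩ (hconn _ _)
      · simp [hnm x hx] at hb
    obtain ⟨f, -, hf₂, hf₃⟩ := hhom
    obtain ⟨hk₁, hk₂⟩ := fold_hom (𝒜 := 𝒜) (𝒞 := pullC T₁ I m) (m := m) hI
      (fun a _ => pullC_self hI m a) hmrole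
    refine ⟨fun x => fold I m (f x).1, fun x a hx => ?_, fun A hA x hx => hk₁ A _ (hf₂ A hA x hx),
      fun p hp x y hxy => hk₂ (.fwd p) _ _ (hf₃ p hp x y hxy)⟩
    have hx' : (univ T₂ 𝒜).nm x.1 = some a := hx
    simp [hnm x.1 x.2] at hx'
  · right
    push Not at hcase
    -- One edge changes the depth by at most one, whence `n + 1` below, and it preserves the root
    -- unless it joins two individuals.
    have hdeep : ∀ y : ((univ T₂ 𝒜).restrict S).dom, ∀ n, ∀ᶠ i in atTop,
        n < (g i y.1).1.depth ∧ (g i y.1).1.root = (g i x₀).1.root := by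
      intro y
      have hy := hconn ⟨x₀, hx₀⟩ y
      induction hy with
      | refl =>
        intro n
        filter_upwards [hcase n] with i hi using ⟨hi, rfl⟩
      | @tail y z _ hstep ih =>
        intro n
        obtain ⟨p, hp, hr⟩ := hstep
        have hev : ∀ᶠ i in atTop, ∃ s, PathEdge 𝒜 s (g i z.1).1 (g i y.1).1 := by
          rcases hr with hr | hr
          · filter_upwards [h₃ p hp _ _ hr] with i hi
            obtain ⟨s, he, -⟩ := chase_ext.1
              (show (chase T₁ 𝒜 (pullC T₁ I m)).ext (.bwd p) _ _ from hi)
            exact ⟨s, he⟩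
          · filter_upwards [h₃ p hp _ _ hr] with i hi
            obtain ⟨s, he, -⟩ := chase_ext.1
              (show (chase T₁ 𝒜 (pullC T₁ I m)).ext (.fwd p) _ _ from hi)
            exact ⟨s, he⟩
        filter_upwards [ih (n + 1), hev] with i h₁ ⟨s, he⟩
        refine ⟨?_, ?_⟩
        · have := he.depth_le
          omega
        · rw [← h₁.2]
          exact (he.root_eq (Or.inr (by omega))).symm
    -- The root may vary with the index. So a finite counterexample is taken for each individual;
    -- some index treats their finite union correctly, and its root refutes the counterexample of
    -- that root.
    by_contra hcon
    push Not at hcon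
    have hbad : ∀ a : 𝒜.ind, ∃ Y : Set ((univ T₂ 𝒜).restrict S).dom, Y.Finite ∧
        ¬ (((univ T₂ 𝒜).restrict S).restrict Y).HomTo sQ (univType NI T₁ (I.tp T₁ (m a))) := by
      intro a
      have := hcon a.1 a.2 (m a) (hm' a.1 a.2)
      simp only [Interp.FinHomTo, Interp.BddHomTo, not_forall] at this
      obtain ⟨n, Y, hY, hno⟩ := this
      exact ⟨Y, Set.finite_of_encard_le_coe hY, hno⟩
    choose Y hYfin hY using hbad
    have : Finite 𝒜.ind := 𝒜.ind_finite
    have hfin : (⋃ a, Y a).Finite := Set.finite_iUnion hYfin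
    obtain ⟨hA, hR⟩ := hc₂.finite_names (hfin.image Subtype.val) (by
      rintro _ ⟨x, -, rfl⟩
      exact hnm x.1 x.2)
    have ev₁ : ∀ᶠ i in atTop, ∀ y ∈ ⋃ a, Y a,
        0 < (g i y.1).1.depth ∧ (g i y.1).1.root = (g i x₀).1.root :=
      (eventually_all_finite hfin).2 fun y _ => hdeep y 0
    have ev₂ : ∀ᶠ i in atTop, ∀ y ∈ ⋃ a, Y a, ∀ A ∈ T₂.concNames, A ∈ sQ.conc →
        y.1 ∈ (univ T₂ 𝒜).conc A → g i y.1 ∈ (chase T₁ 𝒜 (pullC T₁ I m)).conc A := by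
      refine (eventually_all_finite hfin).2 fun y _ =>
        (eventually_all_finite T₂.concNames_finite).2 fun A _ => ?_
      by_cases hAy : A ∈ sQ.conc ∧ y.1 ∈ (univ T₂ 𝒜).conc A
      · filter_upwards [h₂ A hAy.1 y.1 hAy.2] with i hi _ _ using hi
      · exact Eventually.of_forall fun i h₁ h₂ => absurd ⟨h₁, h₂⟩ hAy
    have ev₃ : ∀ᶠ i in atTop, ∀ y ∈ ⋃ a, Y a, ∀ z ∈ ⋃ a, Y a,
        ∀ p ∈ {p | ∃ x ∈ Subtype.val '' (⋃ a, Y a), ∃ y ∈ Subtype.val '' (⋃ a, Y a),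
          (univ T₂ 𝒜).role p x y}, p ∈ sQ.role → (univ T₂ 𝒜).role p y.1 z.1 →
          (chase T₁ 𝒜 (pullC T₁ I m)).role p (g i y.1) (g i z.1) := by
      refine (eventually_all_finite hfin).2 fun y _ =>
        (eventually_all_finite hfin).2 fun z _ => (eventually_all_finite hR).2 fun p _ => ?_
      by_cases hp : p ∈ sQ.role ∧ (univ T₂ 𝒜).role p y.1 z.1
      · filter_upwards [h₃ p hp.1 _ _ hp.2] with i hi _ _ using hi
      · exact Eventually.of_forall fun i h₁ h₂ => absurd ⟨h₁, h₂⟩ hp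
    obtain ⟨i, hi₁, hi₂, hi₃, hi₀⟩ :=
      (ev₁.and (ev₂.and (ev₃.and (hdeep ⟨x₀, hx₀⟩ 0)))).exists
    let a : 𝒜.ind := ⟨(g i x₀).1.root, (g i x₀).2.root_mem⟩
    obtain ⟨f, hf₁, hf₂⟩ := exists_hom_below hI m a.1 ⟨g i x₀, rfl, hi₀.1⟩
    have hsub : ∀ y ∈ Y a, y ∈ ⋃ a, Y a := fun y hy => Set.mem_iUnion.2 ⟨a, hy⟩
    refine hY a ⟨fun y => f (g i y.1.1), fun y b hb => ?_, fun A hAs y hy => ?_,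
      fun p hp y z hyz => ?_⟩
    · have hb' : (univ T₂ 𝒜).nm y.1.1 = some b := hb
      simp [hnm y.1.1 y.1.2] at hb'
    · have hy' := hsub y.1 y.2
      exact hf₁ A _ (hi₁ _ hy').2 (hi₁ _ hy').1
        (hi₂ _ hy' A (hA A _ ⟨y.1, hy', rfl⟩ hy) hAs hy)
    · have hy' := hsub y.1 y.2
      have hz' := hsub z.1 z.2
      exact hf₂ p _ _ (hi₁ _ hy').2 (hi₁ _ hy').1
        (hi₃ _ hy' _ hz' p ⟨_, ⟨y.1, hy', rfl⟩, _, ⟨z.1, hz', rfl⟩, hyz⟩ hp hyz)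

end Forward

/-! ### Walks without immediate returns -/

section Walks

variable {NC NR NI : Type}

/-- Walks from an individual, as lists of steps with the last step first. -/
abbrev Steps (NR NI : Type) := List (Role NR × NI)

/-- The individual at which a walk from `a₀` ends. -/
def walkEnd (a₀ : NI) : Steps NR NI → NI
  | [] => a₀
  | (_, b) :: _ => b

/-- The step along `s` to `b` takes back the last step of the walk. -/
def TakesBack (a₀ : NI) : Steps NR NI → Role NR → NI → Prop
  | [], _, _ => False
  | (s', _) :: w, s, b => s' = s.inv ∧ b = walkEnd a₀ w

/-- The walks in the ABox from `a₀` that never take back a step. -/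
def IsWalk (𝒜 : ABox NC NR NI) (a₀ : NI) : Steps NR NI → Prop
  | [] => True
  | (s, b) :: w => IsWalk 𝒜 a₀ w ∧ 𝒜.HasRole s (walkEnd a₀ w) b ∧ ¬ TakesBack a₀ w s b

/-- Two walks are neighbours along `s`. -/
def WalkEdge (s : Role NR) (w w' : Steps NR NI) : Prop :=
  (∃ b, w' = (s, b) :: w) ∨ ∃ b, w = (s.inv, b) :: w'

theorem WalkEdge.symm {s : Role NR} {w w' : Steps NR NI} (h : WalkEdge s w w') :
    WalkEdge s.inv w' w := by
  rcases h with ⟨b, h⟩ | ⟨b, h⟩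
  · exact Or.inr ⟨b, by simpa using h⟩
  · exact Or.inl ⟨b, h⟩

theorem WalkEdge.role_unique {s s' : Role NR} {w w' : Steps NR NI} (h : WalkEdge s w w')
    (h' : WalkEdge s' w w') : s = s' := by
  rcases h with ⟨b, rfl⟩ | ⟨b, rfl⟩ <;> rcases h' with ⟨b', h'⟩ | ⟨b', h'⟩
  · simp only [List.cons.injEq, Prod.mk.injEq] at h'
    exact h'.1.1
  · have := congrArg List.length h'
    simp at this
    omega
  · have := congrArg List.length h'
    simp at this
    omega
  · simp only [List.cons.injEq, Prod.mk.injEq] at h'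
    rw [← s.inv_inv, h'.1.1, Role.inv_inv]

variable {𝒜 : ABox NC NR NI} {a₀ : NI}

theorem WalkEdge.hasRole {s : Role NR} {w w' : Steps NR NI} (h : WalkEdge s w w')
    (hw : IsWalk 𝒜 a₀ w) (hw' : IsWalk 𝒜 a₀ w') :
    𝒜.HasRole s (walkEnd a₀ w) (walkEnd a₀ w') := by
  rcases h with ⟨b, rfl⟩ | ⟨b, rfl⟩
  · exact hw'.2.1
  · exact (𝒜.hasRole_inv s _ _).1 hw.2.1

/-- Either the last step is taken back or the walk is prolonged. The increase by at most one is the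
distance lost in `holdsInside_of_hasRole`. -/
theorem IsWalk.exists_walkEdge {w' : Steps NR NI} (hw' : IsWalk 𝒜 a₀ w') {s : Role NR} {b : NI}
    (h : 𝒜.HasRole s b (walkEnd a₀ w')) : ∃ w, IsWalk 𝒜 a₀ w ∧ walkEnd a₀ w = b ∧
      w.length ≤ w'.length + 1 ∧ WalkEdge s w w' := by
  by_cases hb : TakesBack a₀ w' s.inv b
  · rcases w' with _ | ⟨⟨s', b'⟩, w⟩
    · exact hb.elim
    · obtain ⟨rfl, rfl⟩ := hb
      exact ⟨w, hw'.1, rfl, by simp; omega, Or.inl ⟨b', by simp⟩⟩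
  · exact ⟨(s.inv, b) :: w', ⟨hw', by simpa using h, hb⟩, rfl, by simp, Or.inr ⟨b, rfl⟩⟩

/-- This is why immediate returns are forbidden: a prolongation along a functional `r` and the
predecessor along `r` would end at the same individual, so the prolongation would take back the last
step. -/
theorem WalkEdge.unique_of_func {r : Role NR} {w w₁ w₂ : Steps NR NI}
    (hf : ∀ a b b', 𝒜.HasRole r a b → 𝒜.HasRole r a b' → b = b') (hw : IsWalk 𝒜 a₀ w)
    (hw₁ : IsWalk 𝒜 a₀ w₁) (hw₂ : IsWalk 𝒜 a₀ w₂) (h₁ : WalkEdge r w w₁)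
    (h₂ : WalkEdge r w w₂) : w₁ = w₂ := by
  have hend := hf _ _ _ (h₁.hasRole hw hw₁) (h₂.hasRole hw hw₂)
  rcases h₁ with ⟨b, rfl⟩ | ⟨b, rfl⟩ <;> rcases h₂ with ⟨b', h₂⟩ | ⟨b', h₂⟩
  · subst h₂
    obtain rfl : b = b' := hend
    rfl
  · subst h₂
    exact absurd ⟨rfl, hend⟩ hw₁.2.2
  · subst h₂
    exact absurd ⟨rfl, hend.symm⟩ hw₂.2.2
  · simp only [List.cons.injEq] at h₂
    exact h₂.2

theorem finite_walks (𝒜 : ABox NC NR NI) (a₀ : NI) (n : ℕ) :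
    {w | IsWalk 𝒜 a₀ w ∧ w.length ≤ n}.Finite := by
  classical
  have hsteps : {x : Role NR × NI | ∃ a, 𝒜.HasRole x.1 a x.2}.Finite := by
    refine ((Role.finite_setOf_name_mem (𝒜.role.image Prod.fst).finite_toSet).prod
      𝒜.ind_finite).subset ?_
    rintro ⟨s, b⟩ ⟨a, h⟩
    refine ⟨?_, h.right_mem⟩
    cases s with
    | fwd p => exact Finset.mem_image.2 ⟨_, h, rfl⟩
    | bwd p => exact Finset.mem_image.2 ⟨_, h, rfl⟩
  induction n with
  | zero =>
    refine (Set.finite_singleton []).subset ?_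
    rintro w ⟨-, hw⟩
    simpa using hw
  | succ n ih =>
    refine ((Set.finite_singleton []).union ((hsteps.prod ih).image fun x => x.1 :: x.2)).subset ?_
    rintro w ⟨hw, hlen⟩
    rcases w with _ | ⟨x, w⟩
    · exact Or.inl rfl
    · exact Or.inr ⟨(x, w), ⟨⟨_, hw.2.1⟩, hw.1, by simpa using hlen⟩, rfl⟩

end Walks

/-! ### Finite unravellings of an ABox -/

section Unravelling

variable {NC NR NI : Type}

theorem finite_unravel_conc (𝒜 : ABox NC NR NI) (ν : Steps NR NI → NI) (a₀ : NI) (n : ℕ) :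
    {x : NC × NI | ∃ w, (IsWalk 𝒜 a₀ w ∧ w.length ≤ n) ∧ (x.1, walkEnd a₀ w) ∈ 𝒜.conc ∧
      x.2 = ν w}.Finite := by
  refine ((𝒜.conc.finite_toSet.prod (finite_walks 𝒜 a₀ n)).image
    fun x => (x.1.1, ν x.2)).subset ?_
  rintro ⟨A, c⟩ ⟨w, hw, hA, hc⟩
  exact ⟨((A, walkEnd a₀ w), w), ⟨hA, hw⟩, Prod.ext rfl hc.symm⟩

theorem finite_unravel_role (𝒜 : ABox NC NR NI) (ν : Steps NR NI → NI) (a₀ : NI) (n : ℕ) :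
    {x : NR × NI × NI | ∃ w w', (IsWalk 𝒜 a₀ w ∧ w.length ≤ n) ∧ (IsWalk 𝒜 a₀ w' ∧
      w'.length ≤ n) ∧ x.2 = (ν w, ν w') ∧ WalkEdge (.fwd x.1) w w'}.Finite := by
  refine ((𝒜.role.finite_toSet.prod ((finite_walks 𝒜 a₀ n).prod (finite_walks 𝒜 a₀ n))).image
    fun x => (x.1.1, ν x.2.1, ν x.2.2)).subset ?_
  rintro ⟨p, c⟩ ⟨w, w', hw, hw', hc, he⟩
  exact ⟨((p, walkEnd a₀ w, walkEnd a₀ w'), w, w'), ⟨he.hasRole hw.1 hw'.1, hw, hw'⟩,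
    Prod.ext rfl hc.symm⟩

/-- The unravelling of the ABox from `a₀` up to depth `n`; the walk `w` is named `ν w`. -/
noncomputable def unravel (𝒜 : ABox NC NR NI) (ν : Steps NR NI → NI) (a₀ : NI) (n : ℕ) :
    ABox NC NR NI where
  conc := (finite_unravel_conc 𝒜 ν a₀ n).toFinset
  role := (finite_unravel_role 𝒜 ν a₀ n).toFinset

variable {𝒜 : ABox NC NR NI} {ν : Steps NR NI → NI} {a₀ : NI} {n : ℕ}

theorem mem_unravel_conc {A : NC} {c : NI} : (A, c) ∈ (unravel 𝒜 ν a₀ n).conc ↔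
    ∃ w, (IsWalk 𝒜 a₀ w ∧ w.length ≤ n) ∧ (A, walkEnd a₀ w) ∈ 𝒜.conc ∧ c = ν w := by
  simp [unravel]

theorem unravel_hasRole {s : Role NR} {c c' : NI} : (unravel 𝒜 ν a₀ n).HasRole s c c' ↔
    ∃ w w', (IsWalk 𝒜 a₀ w ∧ w.length ≤ n) ∧ (IsWalk 𝒜 a₀ w' ∧ w'.length ≤ n) ∧
      c = ν w ∧ c' = ν w' ∧ WalkEdge s w w' := by
  have key : ∀ p c c', (p, c, c') ∈ (unravel 𝒜 ν a₀ n).role ↔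
      ∃ w w', (IsWalk 𝒜 a₀ w ∧ w.length ≤ n) ∧ (IsWalk 𝒜 a₀ w' ∧ w'.length ≤ n) ∧
        c = ν w ∧ c' = ν w' ∧ WalkEdge (.fwd p) w w' := by
    intro p c c'
    simp [unravel, and_assoc]
  cases s with
  | fwd p => exact key p c c'
  | bwd p =>
    refine (key p c' c).trans ⟨?_, ?_⟩
    · rintro ⟨w, w', hw, hw', h, h', he⟩
      exact ⟨w', w, hw', hw, h', h, he.symm⟩
    · rintro ⟨w, w', hw, hw', h, h', he⟩
      exact ⟨w', w, hw', hw, h', h, he.symm⟩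

theorem exists_walk_of_mem_ind {c : NI} (hc : c ∈ (unravel 𝒜 ν a₀ n).ind) :
    ∃ w, (IsWalk 𝒜 a₀ w ∧ w.length ≤ n) ∧ c = ν w := by
  rcases hc with ⟨A, h⟩ | ⟨r, b, h⟩ | ⟨r, b, h⟩
  · obtain ⟨w, hw, -, hc⟩ := mem_unravel_conc.1 h
    exact ⟨w, hw, hc⟩
  · obtain ⟨w, w', hw, -, hc, -⟩ := unravel_hasRole.1
      (show (unravel 𝒜 ν a₀ n).HasRole (.fwd r) c b from h)
    exact ⟨w, hw, hc⟩
  · obtain ⟨w, w', hw, -, hc, -⟩ := unravel_hasRole.1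
      (show (unravel 𝒜 ν a₀ n).HasRole (.bwd r) c b from h)
    exact ⟨w, hw, hc⟩

/-- Depth at least 1 is needed because a root without concept assertions occurs only in the role
assertions of first steps. -/
theorem mem_unravel_ind (ha₀ : a₀ ∈ 𝒜.ind) (hn : 1 ≤ n) {w : Steps NR NI}
    (hw : IsWalk 𝒜 a₀ w) (hlen : w.length ≤ n) : ν w ∈ (unravel 𝒜 ν a₀ n).ind := by
  have hedge : ∀ s b, 𝒜.HasRole s a₀ b → ν [] ∈ (unravel 𝒜 ν a₀ n).ind := by
    intro s b h
    have : (unravel 𝒜 ν a₀ n).HasRole s (ν []) (ν [(s, b)]) := unravel_hasRole.2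
      ⟨[], [(s, b)], ⟨trivial, Nat.zero_le n⟩, ⟨⟨trivial, h, fun h => h⟩, hn⟩, rfl, rfl,
        Or.inl ⟨b, rfl⟩⟩
    exact this.left_mem
  rcases w with _ | ⟨⟨s, b⟩, w⟩
  · rcases ha₀ with ⟨A, h⟩ | ⟨r, b, h⟩ | ⟨r, b, h⟩
    · exact Or.inl ⟨A, mem_unravel_conc.2 ⟨[], ⟨hw, hlen⟩, h, rfl⟩⟩
    · exact hedge (.fwd r) b h
    · exact hedge (.bwd r) b h
  · have : (unravel 𝒜 ν a₀ n).HasRole s (ν w) (ν ((s, b) :: w)) := unravel_hasRole.2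
      ⟨w, _, ⟨hw.1, by simp at hlen; omega⟩, ⟨hw, hlen⟩, rfl, rfl, Or.inl ⟨b, rfl⟩⟩
    exact this.right_mem

theorem unravel_over {sA : Sig NC NR} (h : 𝒜.Over sA) : (unravel 𝒜 ν a₀ n).Over sA := by
  refine ⟨?_, ?_⟩
  · rintro ⟨A, c⟩ hA
    obtain ⟨w, -, hw, -⟩ := mem_unravel_conc.1 hA
    exact h.1 (A, walkEnd a₀ w) hw
  · rintro ⟨p, c, c'⟩ hp
    obtain ⟨w, w', hw, hw', -, -, he⟩ := unravel_hasRole.1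
      (show (unravel 𝒜 ν a₀ n).HasRole (.fwd p) c c' from hp)
    exact h.2 (p, walkEnd a₀ w, walkEnd a₀ w') (he.hasRole hw.1 hw'.1)

/-- The rank is the length of the walk; its only shorter neighbour arises by deleting the last step.
-/
theorem unravel_ranked (hν : Function.Injective ν) (ha₀ : a₀ ∈ 𝒜.ind) (hn : 1 ≤ n) :
    (unravel 𝒜 ν a₀ n).Ranked (fun c => (Function.invFun ν c).length) (ν []) := by
  have hinv : ∀ w, Function.invFun ν (ν w) = w := Function.leftInverse_invFun hν
  refine ⟨?_, ?_, mem_unravel_ind ha₀ hn trivial (Nat.zero_le n), ?_⟩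
  · intro s c c' h
    obtain ⟨w, w', -, -, rfl, rfl, he⟩ := unravel_hasRole.1 h
    simp only [hinv]
    rcases he with ⟨b, rfl⟩ | ⟨b, rfl⟩ <;> simp
  · intro s s' c c₁ c₂ h₁ h₂ hlt₁ hlt₂
    obtain ⟨w, w₁, -, -, rfl, rfl, he₁⟩ := unravel_hasRole.1 h₁
    obtain ⟨w', w₂, -, -, hw, rfl, he₂⟩ := unravel_hasRole.1 h₂
    obtain rfl := hν hw
    simp only [hinv] at hlt₁ hlt₂
    rcases he₁ with ⟨b, rfl⟩ | ⟨b, rfl⟩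
    · simp at hlt₁
    · rcases he₂ with ⟨b', rfl⟩ | ⟨b', h⟩
      · simp at hlt₂
      · simp only [List.cons.injEq] at h
        rw [h.2]
  · intro c hc
    obtain ⟨w, hw, rfl⟩ := exists_walk_of_mem_ind hc
    rcases w with _ | ⟨⟨s, b⟩, w⟩
    · exact Or.inl rfl
    · refine Or.inr ⟨s.inv, ν w, unravel_hasRole.2 ⟨_, w, hw, ⟨hw.1.1, ?_⟩, rfl, rfl,
        Or.inr ⟨b, by simp⟩⟩, by simp [hinv]⟩
      have := hw.2
      simp at this
      omega

theorem unravel_treeShaped (hν : Function.Injective ν) (ha₀ : a₀ ∈ 𝒜.ind) (hn : 1 ≤ n) :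
    (unravel 𝒜 ν a₀ n).TreeShaped := by
  have hr := unravel_ranked (𝒜 := 𝒜) hν ha₀ hn
  refine ⟨fun r c h => hr.ne (.fwd r) c c h rfl, hr.graph_isTree, fun c c' _ => ?_⟩
  have key : ∀ {s s' : Role NR}, (unravel 𝒜 ν a₀ n).HasRole s c c' →
      (unravel 𝒜 ν a₀ n).HasRole s' c c' → s = s' := by
    intro s s' h h'
    obtain ⟨w, w', -, -, rfl, rfl, he⟩ := unravel_hasRole.1 h
    obtain ⟨w₁, w₁', -, -, h₁, h₁', he'⟩ := unravel_hasRole.1 h'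
    obtain rfl := hν h₁
    obtain rfl := hν h₁'
    exact he.role_unique he'
  have hrole : ∀ p : NR × NI × NI, p ∈ (unravel 𝒜 ν a₀ n).role ∧
      (p.2 = (c, c') ∨ p.2 = (c', c)) →
      (p = (p.1, c, c') ∧ (unravel 𝒜 ν a₀ n).HasRole (.fwd p.1) c c') ∨
        (p = (p.1, c', c) ∧ (unravel 𝒜 ν a₀ n).HasRole (.bwd p.1) c c') := by
    rintro ⟨p, cc⟩ ⟨hp, rfl | rfl⟩
    · exact Or.inl ⟨rfl, hp⟩
    · exact Or.inr ⟨rfl, hp⟩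
  intro p hp p' hp'
  rcases hrole p hp with ⟨h, h₁⟩ | ⟨h, h₁⟩ <;> rcases hrole p' hp' with ⟨h', h₁'⟩ | ⟨h', h₁'⟩ <;>
    have hk := key h₁ h₁'
  · rw [h, h', Role.fwd.inj hk]
  · cases hk
  · cases hk
  · rw [h, h', Role.bwd.inj hk]

/-- Types of a model of the ABox can be pulled back to the unravelling. -/
theorem unravel_seed (hν : Function.Injective ν) {T : TBox NC NR} {K : Interp NC NR NI}
    (hK : K.ModelsT T) (hA : K.ModelsA 𝒜) {m : NI → K.dom} (hm : ∀ d a, K.nm d = some a → m a = d) :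
    Seed T (unravel 𝒜 ν a₀ n) (pullC T K fun c => m (walkEnd a₀ (Function.invFun ν c))) ∧
      ∀ s c c', (unravel 𝒜 ν a₀ n).HasRole s c c' →
        K.ext s (m (walkEnd a₀ (Function.invFun ν c)))
          (m (walkEnd a₀ (Function.invFun ν c'))) := by
  have hinv : ∀ w, Function.invFun ν (ν w) = w := Function.leftInverse_invFun hν
  have hm' : ∀ a ∈ 𝒜.ind, K.nm (m a) = some a := by
    intro a ha
    obtain ⟨d, hd⟩ := hA.exists_nm ha
    rwa [hm d a hd]
  have hrole : ∀ s c c', (unravel 𝒜 ν a₀ n).HasRole s c c' →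
      K.ext s (m (walkEnd a₀ (Function.invFun ν c))) (m (walkEnd a₀ (Function.invFun ν c'))) := by
    intro s c c' h
    obtain ⟨w, w', hw, hw', rfl, rfl, he⟩ := unravel_hasRole.1 h
    have hs := he.hasRole hw.1 hw'.1
    rw [hinv, hinv]
    exact hA.ext_of_nm hs (hm' _ hs.left_mem) (hm' _ hs.right_mem)
  refine ⟨Seed.pullback hK ?_ hrole ?_, hrole⟩
  · intro A c h
    obtain ⟨w, -, hw, rfl⟩ := mem_unravel_conc.1 h
    rw [hinv]
    exact hA.conc_of_nm hw (hm' _ (Or.inl ⟨A, hw⟩))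
  · intro r c c₁ c₂ hr h₁ h₂
    obtain ⟨w, w₁, hw, hw₁, rfl, rfl, he₁⟩ := unravel_hasRole.1 h₁
    obtain ⟨w', w₂, hw', hw₂, h, rfl, he₂⟩ := unravel_hasRole.1 h₂
    obtain rfl := hν h
    rw [he₁.unique_of_func (fun a b b' => hA.hasRole_func hK r a b b' hr) hw.1 hw₁.1 hw₂.1 he₂]

theorem unravel_consistent (hν : Function.Injective ν) {T : TBox NC NR} (hc : Consistent T 𝒜)
    (ha₀ : a₀ ∈ 𝒜.ind) (hn : 1 ≤ n) : Consistent T (unravel 𝒜 ν a₀ n) := by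
  obtain ⟨K, hK, hA⟩ := hc
  obtain ⟨m, hm⟩ := exists_naming hK.1
  have hs := (unravel_seed (a₀ := a₀) (n := n) hν hK hA hm).1
  exact ⟨_, hs.chase_modelsT ⟨_, mem_unravel_ind ha₀ hn (w := []) trivial (Nat.zero_le n)⟩,
    hs.chase_modelsA⟩

end Unravelling

/-! ### Concept names that persist away from the border -/

section Persistence

variable {NC NR NI : Type}

/-- In every model of `T` and of an unravelling, the copies of `b` that are at least `k` steps
away from the border satisfy all concept names from `t`. -/
def HoldsInside (T : TBox NC NR) (𝒜 : ABox NC NR NI) (ν : Steps NR NI → NI) (k : ℕ) (b : NI)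
    (t : Set NC) : Prop :=
  ∀ a₀ ∈ 𝒜.ind, ∀ n w, IsWalk 𝒜 a₀ w → walkEnd a₀ w = b → w.length + k ≤ n → 1 ≤ n →
    ∀ M : Interp NC NR NI, M.ModelsT T → M.ModelsA (unravel 𝒜 ν a₀ n) →
      ∀ d, M.nm d = some (ν w) → ∀ C ∈ t, d ∈ M.conc C

/-- The concept names of `T` that hold at all copies of `b` that are far enough from the border
of the unravelling, and those that are asserted. -/
def persistType (T : TBox NC NR) (𝒜 : ABox NC NR NI) (ν : Steps NR NI → NI) (b : NI) : Set NC :=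
  {C | C ∈ T.concNames ∧ ∃ k, HoldsInside T 𝒜 ν k b {C}} ∪ {C | (C, b) ∈ 𝒜.conc}

variable {T : TBox NC NR} {𝒜 : ABox NC NR NI} {ν : Steps NR NI → NI}

/-- Only finitely many names of `T` have a bound of their own, so a common bound exists; asserted
names hold at all copies. -/
theorem exists_holdsInside (T : TBox NC NR) (𝒜 : ABox NC NR NI) (ν : Steps NR NI → NI) (b : NI) :
    ∃ k, HoldsInside T 𝒜 ν k b (persistType T 𝒜 ν b) := by
  classical
  have hex : ∀ C : NC, ∃ k, (∃ k, HoldsInside T 𝒜 ν k b {C}) → HoldsInside T 𝒜 ν k b {C} := by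
    intro C
    by_cases h : ∃ k, HoldsInside T 𝒜 ν k b {C}
    · exact ⟨h.choose, fun _ => h.choose_spec⟩
    · exact ⟨0, fun h' => absurd h' h⟩
  choose k hk using hex
  obtain ⟨N, hN⟩ := (T.concNames_finite.image k).bddAbove
  refine ⟨N, fun a₀ ha₀ n w hw hwb hle hn M hM hMA d hd C hC => ?_⟩
  rcases hC with ⟨hC, h⟩ | hC
  · have := hN ⟨C, hC, rfl⟩
    exact hk C h a₀ ha₀ n w hw hwb (by omega) hn M hM hMA d hd C rfl
  · refine hMA.conc_of_nm (mem_unravel_conc.2 ⟨w, ⟨hw, by omega⟩, ?_, rfl⟩) hd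
    rw [hwb]
    exact hC

/-- A copy of `b'` at distance at least `k + 1` from the border has a neighbouring copy of `b` at
distance at least `k`. -/
theorem holdsInside_of_hasRole {s : Role NR} {b b' : NI} (h : 𝒜.HasRole s b b') {C : NC}
    (hC : ∀ M : Interp NC NR NI, ∀ d d', typeC NI T (persistType T 𝒜 ν b) M d → M.ext s d d' →
      d' ∈ M.conc C) : ∃ k, HoldsInside T 𝒜 ν k b' {C} := by
  obtain ⟨k, hk⟩ := exists_holdsInside T 𝒜 ν b
  refine ⟨k + 1, fun a₀ ha₀ n w' hw' hwb hle hn M hM hMA d' hd' => ?_⟩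
  rintro _ rfl
  subst hwb
  obtain ⟨w, hw, rfl, hlen, he⟩ := hw'.exists_walkEdge h
  have hrole : (unravel 𝒜 ν a₀ n).HasRole s (ν w) (ν w') :=
    unravel_hasRole.2 ⟨w, w', ⟨hw, by omega⟩, ⟨hw', by omega⟩, rfl, rfl, he⟩
  obtain ⟨d, hd⟩ := hMA.exists_nm hrole.left_mem
  exact hC M d d' ⟨hM, hk a₀ ha₀ n w hw rfl (by omega) hn M hM hMA d hd⟩
    (hMA.ext_of_nm hrole hd hd')

/-- Propagation along an edge of `𝒜` costs one unit of distance, which persistence tolerates.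
Satisfiability of a persistent type is seen at the root of a deep enough unravelling. -/
theorem persist_seed (hν : Function.Injective ν) (hc : Consistent T 𝒜) :
    Seed T 𝒜 fun b => typeC NI T (persistType T 𝒜 ν b) where
  sound b hb := by
    obtain ⟨k, hk⟩ := exists_holdsInside T 𝒜 ν b
    obtain ⟨M, hM, hMA⟩ := unravel_consistent hν hc hb (le_max_right k 1)
    obtain ⟨d, hd⟩ := hMA.exists_nm
      (mem_unravel_ind hb (le_max_right k 1) (w := []) trivial (Nat.zero_le _))
    exact typeC_sound_of_mem hM (hk b hb (max k 1) [] trivial rfl (by simp) (le_max_right k 1)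
      M hM hMA d hd)
  conc A a h := subset_lab_typeC (Or.inr h)
  realizable := hc.seed.realizable
  all s a b hab A r B hax hs hA := subset_lab_typeC <| Or.inl
    ⟨⟨_, hax, by simp [Ax.concNames]⟩, holdsInside_of_hasRole hab fun M d d' hd hdd' =>
      hd.1.2 _ hax d (hA M d hd) d' (hs M hd.1 d d' hdd')⟩
  funcEx r a b hr hab B hB hex := subset_lab_typeC <| Or.inl
    ⟨hB, holdsInside_of_hasRole hab fun M d d' hd hdd' => by
      obtain ⟨e, he, hBe⟩ := hex M d hd
      obtain rfl := hd.1.2 _ hr d d' e hdd' he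
      exact hBe B rfl⟩
  func := hc.seed.func

end Persistence

/-! ### From homomorphisms to query entailment -/

section Backward

variable {NC NR NI : Type}

/-- If the connected part and the subtrees of `V` map to `I₁` or, finitely, to the universal model
of a type of `I₁`, then finite parts of connected components of `V` map to everything to which
`I₁` maps. -/
theorem exists_component_hom [Nonempty NI] {sQ : Sig NC NR} {T₁ : TBox NC NR}
    {V I₁ K : Interp NC NR NI} (hcon : (V.con sQ).HomTo sQ I₁)
    (hsub : ∀ S : Set V.dom, V.IsSubtree sQ S → (V.restrict S).HomTo sQ I₁ ∨
      ∃ d : I₁.dom, (V.restrict S).FinHomTo sQ (univType NI T₁ (I₁.tp T₁ d)))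
    (hcomp : ∀ x, (∀ y, Relation.ReflTransGen (V.Step sQ) x y → V.nm y = none) →
      V.IsSubtree sQ {y | Relation.ReflTransGen (V.Step sQ) x y})
    (hK : K.ModelsT T₁) {f : I₁.dom → K.dom} (hfc : ∀ A, ∀ d ∈ I₁.conc A, f d ∈ K.conc A)
    (hfr : ∀ p d e, I₁.role p d e → K.role p (f d) (f e)) (x : V.dom) {F : Set V.dom}
    (hF : F.Finite) : ∃ g : V.dom → K.dom,
      (∀ z ∈ F, Relation.ReflTransGen (V.Step sQ) x z → ∀ b, V.nm z = some b →
        ∃ d, I₁.nm d = some b ∧ g z = f d) ∧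
      (∀ z ∈ F, Relation.ReflTransGen (V.Step sQ) x z → ∀ A ∈ sQ.conc, z ∈ V.conc A →
        g z ∈ K.conc A) ∧
      ∀ z ∈ F, Relation.ReflTransGen (V.Step sQ) x z → ∀ z' ∈ F,
        Relation.ReflTransGen (V.Step sQ) x z' → ∀ p ∈ sQ.role, V.role p z z' →
          K.role p (g z) (g z') := by
  classical
  -- The component of `x` either contains an individual and lies in the connected part, or it is
  -- itself a subtree.
  by_cases hx : ∃ c a, V.nm c = some a ∧ Relation.ReflTransGen (V.Step sQ) c x
  · obtain ⟨c, a, hc, hcx⟩ := hx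
    obtain ⟨g, h₁, h₂, h₃⟩ := hcon
    have hmem : ∀ z, Relation.ReflTransGen (V.Step sQ) x z →
        ∃ c a, V.nm c = some a ∧ Relation.ReflTransGen (V.Step sQ) c z :=
      fun z hz => ⟨c, a, hc, hcx.trans hz⟩
    refine ⟨fun z => if hz : ∃ c a, V.nm c = some a ∧ Relation.ReflTransGen (V.Step sQ) c z
      then f (g ⟨z, hz⟩) else hK.1.some, fun z _ hz b hb => ?_, fun z _ hz A hA hzA => ?_,
      fun z _ hz z' _ hz' p hp hr => ?_⟩
    · exact ⟨g ⟨z, hmem z hz⟩, h₁ _ b hb, by simp only [dif_pos (hmem z hz)]⟩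
    · simp only [dif_pos (hmem z hz)]
      exact hfc A _ (h₂ A hA _ hzA)
    · simp only [dif_pos (hmem z hz), dif_pos (hmem z' hz')]
      exact hfr p _ _ (h₃ p hp _ _ hr)
  · have hnone : ∀ y, Relation.ReflTransGen (V.Step sQ) x y → V.nm y = none := by
      intro y hy
      by_contra hne
      obtain ⟨a, ha⟩ := Option.ne_none_iff_exists'.1 hne
      exact hx ⟨y, a, ha, Interp.reach_symm hy⟩
    rcases hsub _ (hcomp x hnone) with ⟨g, -, h₂, h₃⟩ | ⟨d, hd⟩
    · refine ⟨fun z => if hz : Relation.ReflTransGen (V.Step sQ) x z then f (g ⟨z, hz⟩)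
        else hK.1.some, fun z _ hz b hb => ?_, fun z _ hz A hA hzA => ?_,
        fun z _ hz z' _ hz' p hp hr => ?_⟩
      · simp [hnone z hz] at hb
      · simp only [dif_pos hz]
        exact hfc A _ (h₂ A hA ⟨z, hz⟩ hzA)
      · simp only [dif_pos hz, dif_pos hz']
        exact hfr p _ _ (h₃ p hp ⟨z, hz⟩ ⟨z', hz'⟩ hr)
    · let Y : Set (V.restrict {y | Relation.ReflTransGen (V.Step sQ) x y}).dom := {y | y.1 ∈ F}
      have hY : Y.Finite := hF.preimage Subtype.val_injective.injOn
      obtain ⟨g, -, h₂, h₃⟩ := hd Y.ncard Y hY.cast_ncard_eq.ge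
      obtain ⟨k, hk₂, hk₃⟩ := univType_hom hK (t := I₁.tp T₁ d) (e := f d)
        fun B hB => hfc B d (Interp.mem_tp.1 hB).2
      refine ⟨fun z => if hz : ∃ hz : Relation.ReflTransGen (V.Step sQ) x z, z ∈ F
        then k (g ⟨⟨z, hz.1⟩, hz.2⟩) else hK.1.some, fun z _ hz b hb => ?_,
        fun z hzF hz A hA hzA => ?_, fun z hzF hz z' hzF' hz' p hp hr => ?_⟩
      · simp [hnone z hz] at hb
      · simp only [dif_pos (show ∃ hz : Relation.ReflTransGen (V.Step sQ) x z, z ∈ F from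
          ⟨hz, hzF⟩)]
        exact hk₂ A _ (h₂ A hA ⟨⟨z, hz⟩, hzF⟩ hzA)
      · simp only [dif_pos (show ∃ hz : Relation.ReflTransGen (V.Step sQ) x z, z ∈ F from
          ⟨hz, hzF⟩), dif_pos (show ∃ hz : Relation.ReflTransGen (V.Step sQ) x z', z' ∈ F from
          ⟨hz', hzF'⟩)]
        exact hk₃ p _ _ (h₃ p hp ⟨⟨z, hz⟩, hzF⟩ ⟨⟨z', hz'⟩, hzF'⟩ hr)

/-- The homomorphism condition on tree-shaped ABoxes. -/
def TreeCondition (NI : Type) [Nonempty NI] (sA sQ : Sig NC NR) (T₁ T₂ : TBox NC NR) : Prop :=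
  ∀ 𝒜 : ABox NC NR NI, 𝒜.TreeShaped → 𝒜.Over sA → Consistent T₁ 𝒜 → Consistent T₂ 𝒜 →
    ∀ I₁ : Interp NC NR NI, I₁.WeaklyTreeShaped → I₁.FinitelyBranching → I₁.ModelsA 𝒜 →
      I₁.ModelsT T₁ → ((univ T₂ 𝒜).con sQ).HomTo sQ I₁ ∧
        ∀ S : Set (univ T₂ 𝒜).dom, (univ T₂ 𝒜).IsSubtree sQ S →
          ((univ T₂ 𝒜).restrict S).HomTo sQ I₁ ∨ ∃ a ∈ 𝒜.ind, ∃ d : I₁.dom, I₁.nm d = some a ∧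
            ((univ T₂ 𝒜).restrict S).FinHomTo sQ (univType NI T₁ (I₁.tp T₁ d))

/-- A step along the signature that does not connect two individuals. -/
def TreeStep {T : TBox NC NR} {𝒜 : ABox NC NR NI} {𝒞 : NI → PClass NC NR NI} (sg : Sig NC NR)
    (x y : (chase T 𝒜 𝒞).dom) : Prop :=
  (chase T 𝒜 𝒞).Step sg x y ∧ (x.1.depth ≠ 0 ∨ y.1.depth ≠ 0)

theorem TreeStep.symm {T : TBox NC NR} {𝒜 : ABox NC NR NI} {𝒞 : NI → PClass NC NR NI}
    {sg : Sig NC NR} {x y : (chase T 𝒜 𝒞).dom} (h : TreeStep sg x y) : TreeStep sg y x :=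
  ⟨h.1.symm, h.2.symm⟩

theorem TreeStep.root_eq {T : TBox NC NR} {𝒜 : ABox NC NR NI} {𝒞 : NI → PClass NC NR NI}
    {sg : Sig NC NR} {x y : (chase T 𝒜 𝒞).dom} (h : TreeStep sg x y) : y.1.root = x.1.root := by
  obtain ⟨⟨p, -, hp⟩, hd⟩ := h
  obtain ⟨r, hr, -⟩ := Interp.exists_ext_of_role hp
  obtain ⟨s, he, -⟩ := chase_ext.1 hr
  exact he.root_eq hd

/-- The chase from the persistent types. -/
abbrev persistChase (T : TBox NC NR) (𝒜 : ABox NC NR NI) (ν : Steps NR NI → NI) :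
    Interp NC NR NI :=
  chase T 𝒜 fun b => typeC NI T (persistType T 𝒜 ν b)

/-- Finite parts of the components of the trees below individuals map to every model of `T₁`. -/
theorem TreeCondition.exists_tree_hom [Nonempty NI] {sA sQ : Sig NC NR} {T₁ T₂ : TBox NC NR}
    (h : TreeCondition NI sA sQ T₁ T₂) {ν : Steps NR NI → NI} (hν : Function.Injective ν)
    {𝒜 : ABox NC NR NI} (hov : 𝒜.Over sA) (hc₂ : Consistent T₂ 𝒜) {K : Interp NC NR NI}
    (hK : K.ModelsT T₁) (hKA : K.ModelsA 𝒜)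
    (x : (persistChase T₂ 𝒜 ν).dom)
    {X : Set (persistChase T₂ 𝒜 ν).dom} (hX : X.Finite) :
    ∃ g : (persistChase T₂ 𝒜 ν).dom → K.dom,
      (∀ y ∈ X, Relation.ReflTransGen (TreeStep sQ) x y → ∀ b, y.1 = .base b →
        K.nm (g y) = some b) ∧
      (∀ y ∈ X, Relation.ReflTransGen (TreeStep sQ) x y → ∀ A ∈ sQ.conc,
        y ∈ (persistChase T₂ 𝒜 ν).conc A →
          g y ∈ K.conc A) ∧
      ∀ y ∈ X, Relation.ReflTransGen (TreeStep sQ) x y → ∀ z ∈ X,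
        Relation.ReflTransGen (TreeStep sQ) x z → (y.1.depth ≠ 0 ∨ z.1.depth ≠ 0) →
          ∀ p ∈ sQ.role,
            (persistChase T₂ 𝒜 ν).role p y z →
              K.role p (g y) (g z) := by
  obtain ⟨a, ha⟩ : ∃ a, x.1.root = a := ⟨_, rfl⟩
  have haind : a ∈ 𝒜.ind := ha ▸ x.2.root_mem
  obtain ⟨k, hk⟩ := exists_holdsInside T₂ 𝒜 ν a
  -- Depth at least `k` forces the persistent type of `a` at the root; depth at least 1 makes the
  -- root an individual of the unravelling.
  obtain ⟨n, hkn, hn⟩ : ∃ n, k ≤ n ∧ 1 ≤ n := ⟨max k 1, le_max_left .., le_max_right ..⟩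
  obtain ⟨m, hm⟩ := exists_naming hK.1
  have hc₂' := unravel_consistent hν hc₂ haind hn
  have hroot : ν [] ∈ (unravel 𝒜 ν a n).ind := mem_unravel_ind haind hn trivial (Nat.zero_le n)
  obtain ⟨hseed, hrole⟩ := unravel_seed (a₀ := a) (n := n) hν hK hKA hm
  have hV := hc₂'.univ_modelsT ⟨_, hroot⟩
  have hVA := hc₂'.univ_modelsA
  obtain ⟨v₀, hv₀⟩ := hVA.exists_nm hroot
  have hv₀C : typeC NI T₂ (persistType T₂ 𝒜 ν a) (univ T₂ (unravel 𝒜 ν a n)) v₀ :=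
    ⟨hV, hk a haind n [] trivial rfl (by simpa using hkn) hn _ hV hVA v₀ hv₀⟩
  -- The condition is applied to the chase of `T₁` from types pulled back from `K`: it has the
  -- required shape even if `K` does not, and it folds into `K`.
  obtain ⟨hcon, hsub⟩ := h _ (unravel_treeShaped hν haind hn) (unravel_over hov)
    (unravel_consistent hν ⟨K, hK, hKA⟩ haind hn) hc₂' _
    ((unravel_ranked hν haind hn).chase_weaklyTreeShaped _)
    (Seed.chase_finitelyBranching (τ := fun c => {A | m (walkEnd a (Function.invFun ν c)) ∈
      K.conc A}) hseed)
    hseed.chase_modelsA (hseed.chase_modelsT ⟨_, hroot⟩)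
  obtain ⟨hf₁, hf₂⟩ := fold_hom (𝒜 := unravel 𝒜 ν a n) (T := T₁) hK
    (fun c _ => pullC_self hK (fun c => m (walkEnd a (Function.invFun ν c))) c) hrole
  -- Every root is sent to `v₀`, which is meaningful only for the tree below `a`; nothing is claimed
  -- for the others.
  let e : (persistChase T₂ 𝒜 ν).dom → (univ T₂ (unravel 𝒜 ν a n)).dom := fun y => fold _ (fun _ => v₀) y.1
  have hreach : ∀ y, Relation.ReflTransGen (TreeStep sQ) x y → y.1.root = a := by
    intro y hy
    induction hy with
    | refl => exact ha
    | tail _ hs ih => exact hs.root_eq.trans ih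
  have hnext : ∀ y : (persistChase T₂ 𝒜 ν).dom, y.1.root = a →
      ∀ r t, (typeC NI T₂ (persistType T₂ 𝒜 ν y.1.root)).Next T₂ r t →
        ∃ e, (univ T₂ (unravel 𝒜 ν a n)).ext r v₀ e ∧
          ∀ B ∈ t, e ∈ (univ T₂ (unravel 𝒜 ν a n)).conc B := by
    intro y hy
    rw [hy]
    exact PClass.Next.exists_of_mem hv₀C
  have he₁ : ∀ y : (persistChase T₂ 𝒜 ν).dom, y.1.root = a → ∀ A, y ∈ (persistChase T₂ 𝒜 ν).conc A →
      e y ∈ (univ T₂ (unravel 𝒜 ν a n)).conc A := by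
    intro y hy A hA
    by_cases hd : y.1.depth = 0
    · obtain ⟨π, hπ⟩ := y
      cases π with
      | base b =>
        obtain rfl : b = a := hy
        exact hA _ v₀ hv₀C
      | snoc π r t => simp [RawPath.depth] at hd
    · exact fold_conc hV (hnext y hy) hd hA
  have he₂ : ∀ y z : (persistChase T₂ 𝒜 ν).dom, y.1.root = a → (y.1.depth ≠ 0 ∨ z.1.depth ≠ 0) → ∀ r,
      (persistChase T₂ 𝒜 ν).ext r y z → (univ T₂ (unravel 𝒜 ν a n)).ext r (e y) (e z) :=
    fun y z hy hd r hr => fold_ext hV (hnext y hy) hd hr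
  have he₃ : ∀ y, Relation.ReflTransGen (TreeStep sQ) x y →
      Relation.ReflTransGen ((univ T₂ (unravel 𝒜 ν a n)).Step sQ) (e x) (e y) := by
    intro y hy
    induction hy with
    | refl => exact .refl
    | tail hy hs ih =>
      refine ih.tail ?_
      obtain ⟨⟨p, hp, hr⟩, hd⟩ := hs
      obtain ⟨r, hr', rfl⟩ := Interp.exists_ext_of_role hr
      exact ⟨r.name, hp, Interp.role_of_ext (he₂ _ _ (hreach _ hy) hd r hr')⟩
  obtain ⟨g, hg₁, hg₂, hg₃⟩ := exists_component_hom hcon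
    (fun S hS => (hsub S hS).imp id fun ⟨_, _, d, _, hd⟩ => ⟨d, hd⟩) univ_isSubtree hK hf₁
    (fun p d d' hdd' => hf₂ (.fwd p) d d' hdd') (e x) (hX.image e)
  refine ⟨fun y => g (e y), fun y hyX hy b hb => ?_, fun y hyX hy A hA hyA => ?_,
    fun y hyX hy z hzX hz hd p hp hr => ?_⟩
  · obtain rfl : b = a := by
      have := hreach y hy
      rwa [hb] at this
    have hey : e y = v₀ := by
      change fold _ (fun _ => v₀) y.1 = v₀
      rw [hb]
      rfl
    obtain ⟨d, hd, hgd⟩ := hg₁ (e y) ⟨y, hyX, rfl⟩ (he₃ y hy) (ν []) (by rw [hey, hv₀])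
    have hd' : d.1 = .base (ν []) := RawPath.nm_eq_some.1 hd
    beta_reduce
    rw [hgd, hd']
    change K.nm (m (walkEnd b (Function.invFun ν (ν [])))) = some b
    rw [Function.leftInverse_invFun hν []]
    obtain ⟨d₀, hd₀⟩ := hKA.exists_nm haind
    rw [walkEnd, hm d₀ b hd₀, hd₀]
  · exact hg₂ _ ⟨y, hyX, rfl⟩ (he₃ y hy) A hA (he₁ y (hreach y hy) A hyA)
  · exact hg₃ _ ⟨y, hyX, rfl⟩ (he₃ y hy) _ ⟨z, hzX, rfl⟩ (he₃ z hz) p hp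
      (he₂ y z (hreach y hy) hd (.fwd p) hr)

theorem TreeCondition.cqEntails [Countable NR] [Countable NI] [Infinite NI]
    {sA sQ : Sig NC NR} {T₁ T₂ : TBox NC NR} (h : TreeCondition NI sA sQ T₁ T₂)
    (hRI : RIEntails NI sA sQ T₁ T₂) : CQEntails NI sA sQ T₁ T₂ := by
  classical
  intro 𝒜 hne hov _ hc₂ q hq a _ hcert K hK hKA
  obtain ⟨ν, hν⟩ : ∃ ν : Steps NR NI → NI, Function.Injective ν := by
    obtain ⟨i, hi⟩ := exists_injective_nat (Steps NR NI)
    exact ⟨fun w => Infinite.natEmbedding NI (i w), (Infinite.natEmbedding NI).injective.comp hi⟩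
  have hseed := persist_seed hν hc₂
  obtain ⟨π, hπ₁, hπ₂, hπ₃⟩ := hcert (persistChase T₂ 𝒜 ν) (hseed.chase_modelsT hne) hseed.chase_modelsA
  have hX : (Set.range π).Finite := Set.finite_range π
  choose g hg₁ hg₂ hg₃ using fun x => h.exists_tree_hom hν hov hc₂ hK hKA x hX
  -- Elements of one component must be moved by the same map, so the map is chosen by a
  -- representative of the component.
  let st : Setoid (persistChase T₂ 𝒜 ν).dom := ⟨Relation.ReflTransGen (TreeStep sQ), fun _ => .refl, fun hxy => by
    induction hxy with
    | refl => exact .refl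
    | tail _ hs ih => exact .head hs.symm ih, fun h h' => h.trans h'⟩
  let rep : (persistChase T₂ 𝒜 ν).dom → (persistChase T₂ 𝒜 ν).dom := fun x => (Quotient.mk st x).out
  have hrep : ∀ x, Relation.ReflTransGen (TreeStep sQ) (rep x) x := fun x =>
    Quotient.exact (s := st) (Quotient.out_eq _)
  have hrep' : ∀ x y, TreeStep sQ x y → rep x = rep y := fun x y hxy =>
    congrArg Quotient.out (Quotient.sound (s := st) (Relation.ReflTransGen.single hxy))
  refine ⟨fun v => g (rep (π v)) (π v), fun p hp => ?_, fun p hp => ?_, fun i => ?_⟩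
  · exact hg₂ _ _ ⟨_, rfl⟩ (hrep _) p.1 (hq.1 p hp) (hπ₁ p hp)
  · have hr := hπ₂ p hp
    by_cases hd : (π p.2.1).1.depth ≠ 0 ∨ (π p.2.2).1.depth ≠ 0
    · have hst : TreeStep sQ (π p.2.1) (π p.2.2) := ⟨⟨p.1, hq.2 p hp, Or.inl hr⟩, hd⟩
      have := hg₃ (rep (π p.2.1)) (π p.2.1) ⟨_, rfl⟩ (hrep _) (π p.2.2) ⟨_, rfl⟩
        ((hrep _).tail hst) hd p.1 (hq.2 p hp) hr
      beta_reduce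
      rwa [hrep' _ _ hst] at this ⊢
    -- Both ends are individuals, which all the maps send to the elements of the same name in `K`.
    -- The edge comes from an assertion over `sA`, so the assumed role inclusions apply.
    · push Not at hd
      obtain ⟨s, he, hs⟩ := chase_ext.1 (show (persistChase T₂ 𝒜 ν).ext (.fwd p.1) _ _ from hr)
      rcases he with ⟨b, b', hb, hb', hbb'⟩ | ⟨t, ht⟩ | ⟨t, ht⟩
      · have h₁ := hg₁ _ _ ⟨_, rfl⟩ (hrep (π p.2.1)) b hb
        have h₂ := hg₁ _ _ ⟨_, rfl⟩ (hrep (π p.2.2)) b' hb'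
        have hsA : s.name ∈ sA.role := by
          cases s with
          | fwd r => exact hov.2 _ hbb'
          | bwd r => exact hov.2 _ hbb'
        exact hRI s (.fwd p.1) hsA (hq.2 p hp) hs K hK _ _ (hKA.ext_of_nm hbb' h₁ h₂)
      · rw [ht] at hd
        simp [RawPath.depth] at hd
      · rw [ht] at hd
        simp [RawPath.depth] at hd
  · exact hg₁ _ _ ⟨_, rfl⟩ (hrep _) (a i) (RawPath.nm_eq_some.1 (hπ₃ i))

theorem CQEntails.treeCondition [Nonempty NI] {sA sQ : Sig NC NR} {T₁ T₂ : TBox NC NR}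
    (h : CQEntails NI sA sQ T₁ T₂) : TreeCondition NI sA sQ T₁ T₂ := by
  intro 𝒜 htree hov _ hc₂ I _ hfb hIA hI
  obtain ⟨a⟩ := htree.2.1.1.nonempty
  exact ⟨h.con_homTo ⟨a, a.2⟩ hov hc₂ hfb hI hIA,
    fun S hS => h.subtree_homTo ⟨a, a.2⟩ hov hc₂ hI hIA hS⟩

end Backward

end HornDL

theorem mainTheorem4 {NC NR NI : Type} [Countable NC] [Infinite NC] [Countable NR] [Infinite NR]
    [Countable NI] [Infinite NI] (sA sQ : HornDL.Sig NC NR) (T₁ T₂ : HornDL.TBox NC NR)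
    (hRI : HornDL.RIEntails NI sA sQ T₁ T₂) :
    HornDL.CQEntails NI sA sQ T₁ T₂ ↔
      ∀ 𝒜 : HornDL.ABox NC NR NI, 𝒜.TreeShaped → 𝒜.Over sA →
        HornDL.Consistent T₁ 𝒜 → HornDL.Consistent T₂ 𝒜 →
        ∀ I₁ : HornDL.Interp NC NR NI, I₁.WeaklyTreeShaped → I₁.FinitelyBranching →
          I₁.ModelsA 𝒜 → I₁.ModelsT T₁ →
          ((HornDL.univ T₂ 𝒜).con sQ).HomTo sQ I₁ ∧
          ∀ S : Set (HornDL.univ T₂ 𝒜).dom, (HornDL.univ T₂ 𝒜).IsSubtree sQ S →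
            ((HornDL.univ T₂ 𝒜).restrict S).HomTo sQ I₁ ∨
            ∃ a ∈ 𝒜.ind, ∃ d : I₁.dom, I₁.nm d = some a ∧
              ((HornDL.univ T₂ 𝒜).restrict S).FinHomTo sQ (HornDL.univType NI T₁ (I₁.tp T₁ d)) :=
  ⟨HornDL.CQEntails.treeCondition, fun h => HornDL.TreeCondition.cqEntails h hRI⟩
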